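/- Let $q\in\mathbb C$ with $0<|q|<1$, let $q^{1/2}$ be a fixed square root of $q$, and let $(x;q)_n=\prod_{j=0}^{n-1}(1-xq^j)$ for $n\in\mathbb Z_{\ge 0}\cup\{\infty\}$, $(x_1,\dots,x_m;q)_n=\prod_r(x_r;q)_n$. In compact quotients everything after the slash is in the denominator, so $c/de=c/(de)$. **Taylor remainders.** For a function $f$ put $$(D_qf)(z)=\frac{f(q^{1/2}z)-f(q^{-1/2}z)}{(q^{1/2}-q^{-1/2})(z-z^{-1})/2},$$ $$D_{c,q}=(1-czq^{-1/2})(1-czq^{1/2})(1-cq^{-1/2}/z)(1-cq^{1/2}/z)\,D_q,$$ $D^{(0)}_{c,q}=\mathrm{Id}$, $D^{(k)}_{c,q}=D_{cq^{3(k-1)/2},q}\,D^{(k-1)}_{c,q}$ for $k\ge1$, and $$\Phi_k(z;a,c)=\frac{(az,a/z;q)_k}{(cz,c/z;q)_k},\qquad t_k^{(a,c)}(f)=\frac{(-1)^kq^{-k(k-1)/4}(1-q)^k}{(2a)^k(q,c/a,acq^{k-1};q)_k}\Bigl[D^{(k)}_{c,q}f(z)\Bigr]_{z=aq^{k/2}},$$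 $$R_n^{(a,c)}f(z)=f(z)-\sum_{k=0}^n t_k^{(a,c)}(f)\,\Phi_k(z;a,c).$$ **The kernels.** For $b,c,d,e\in\mathbb C\setminus\{0\}$ put $$A(z)=\frac{(cz/de,c/dez;q)_\infty}{(c^2z/bde,c^2/bdez;q)_\infty},\qquad B(z)=\frac{(bz,b/z;q)_\infty}{(cz,c/z;q)_\infty},\qquad \Psi_k(z)=\Phi_k\bigl(z;c/de,c^2/bde\bigr),$$ $$H(z)=\frac{(cz/d,c/dz,cz/e,c/ez;q)_\infty}{(cz,c/z,cz/de,c/dez;q)_\infty},\qquad K(z)=\frac{(cz/d,c/dz,cz/e,c/ez;q)_\infty}{(bz,b/z,c^2z/bde,c^2/bdez;q)_\infty},$$ $$f_k=\frac{1-bcq^{2k-1}}{1-bcq^{-1}}\frac{(bcq^{-1},d,e,c^2/deq;q)_k}{(q,bc/d,bc/e,bdeq/c;q)_k}q^k,$$ $$g_k=\frac{1-c^3q^{2k-1}/bd^2e^2}{1-c^3/bd^2e^2q}\frac{(c^3/bd^2e^2q,c/bd,c/be,c^2/deq;q)_k}{(q,c^2/de^2,c^2/d^2e,cq/bde;q)_k}q^k.$$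 **Genericity.** Assume that the denominators of $H(b)$, $K(c/de)$ and of all $f_k$, $g_k$ are nonzero, that $H$ has no vanishing denominator factor at any point $bq^m$ and $K$ none at any point $(c/de)q^m$ $(m\ge0)$, and that $b^2q^i\ne1$ and $(c/de)^2q^i\neq1$ for all $i\ge1$ (so that the divided differences defining the Taylor coefficients below are defined). **Statement.** Let $\Omega_H$ be the set of $z\in\mathbb C\setminus\{0\}$ at which $(cz,c/z,c^2z/bde,c^2/bdez,cz/de,c/dez;q)_\infty\ne0$, and $\Omega_K$ the set of $z\in\mathbb C\setminus\{0\}$ at which $(cz,c/z,c^2z/bde,c^2/bdez,bz,b/z;q)_\infty\neq0$. (i) For all $z\in\Omega_H$ and $n\ge0$ the series below converge absolutely, and $$A(z)R_n^{(b,c)}H(z)=A(z)H(b)\sum_{k=n+1}^\infty f_k\Phi_k(z;b,c)+B(z)K(c/de)\sum_{k=0}^\infty g_k\Psi_k(z).$$ Hence, as $n\to\infty$, $$A(z)R_n^{(b,c)}H(z)\longrightarrow B(z)K(c/de)\sum_{k=0}^\infty g_k\Psi_k(z)$$ uniformly on compact subsets of $\Omega_H$; and if $K(c/de)\neq0$,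 this limit does not vanish identically on $\Omega_H$. (ii) For all $z\in\Omega_K$ and $n\ge0$ the series below converge absolutely, and $$B(z)R_n^{(c/de,\,c^2/bde)}K(z)=B(z)K(c/de)\sum_{k=n+1}^\infty g_k\Psi_k(z)+A(z)H(b)\sum_{k=0}^\infty f_k\Phi_k(z;b,c).$$ Hence, as $n\to\infty$, $$B(z)R_n^{(c/de,\,c^2/bde)}K(z)\longrightarrow A(z)H(b)\sum_{k=0}^\infty f_k\Phi_k(z;b,c)$$ uniformly on compact subsets of $\Omega_K$; and if $H(b)\ne0$, this limit does not vanish identically on $\Omega_K$. -/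

import Mathlib

namespace WPTaylor

noncomputable section

/-! ### `q`-shifted factorials -/

/-- The finite `q`-shifted factorial `(x; q)_n`. -/
def qPoch (q x : ℂ) (n : ℕ) : ℂ := ∏ j ∈ Finset.range n, (1 - x * q ^ j)

/-- The infinite `q`-shifted factorial `(x; q)_∞`. -/
def qPochInf (q x : ℂ) : ℂ := ∏' j : ℕ, (1 - x * q ^ j)

/-- No factor of `(x; q)_∞` vanishes; so `(x; q)_∞` and every `(x; q)_n` may be divided by. -/
def QRegular (q x : ℂ) : Prop := ∀ m : ℕ, x * q ^ m ≠ 1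

/-! ### The well-poised Taylor calculus

Throughout, `s` is a fixed square root `q^{1/2}` of `q`. -/

/-- The well-poised monomial `Φ_k(z; a, c) = (az, a/z; q)_k / (cz, c/z; q)_k`. -/
def Phi (q a c : ℂ) (k : ℕ) (z : ℂ) : ℂ :=
  (qPoch q (a * z) k * qPoch q (a / z) k) / (qPoch q (c * z) k * qPoch q (c / z) k)

/-- The Askey–Wilson divided-difference operator `D_q`. -/
def askeyWilsonD (s : ℂ) (f : ℂ → ℂ) (z : ℂ) : ℂ :=
  (f (s * z) - f (s⁻¹ * z)) / ((s - s⁻¹) * (z - z⁻¹) / 2)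

/-- The well-poised operator `D_{c,q}`. -/
def wpD (s c : ℂ) (f : ℂ → ℂ) (z : ℂ) : ℂ :=
  (1 - c * z * s⁻¹) * (1 - c * z * s) * (1 - c * s⁻¹ / z) * (1 - c * s / z) * askeyWilsonD s f z

/-- The iterated operators `D_{c,q}^{(0)} = Id`, `D_{c,q}^{(k+1)} = D_{c q^{3k/2}, q} D_{c,q}^{(k)}`. -/
def wpDIter (s c : ℂ) : ℕ → (ℂ → ℂ) → ℂ → ℂ
  | 0, f => f
  | k + 1, f => wpD s (c * s ^ (3 * k)) (wpDIter s c k f)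

/-- The well-poised Taylor coefficient `t_k^{(a,c)}(f)`; here `q^{k(k-1)/4} = s ^ (k choose 2)`
and `c a q^{k-1} = c a q^k / q`. -/
def taylorCoeff (q s a c : ℂ) (f : ℂ → ℂ) (k : ℕ) : ℂ :=
  (-1) ^ k * (s ^ k.choose 2)⁻¹ * (1 - q) ^ k /
      ((2 * a) ^ k * (qPoch q q k * qPoch q (c / a) k * qPoch q (a * c * q ^ k / q) k)) *
    wpDIter s c k f (a * s ^ k)

/-- The `n`th Taylor sum `T_n^{(a,c)} f`. -/
def taylorSum (q s a c : ℂ) (f : ℂ → ℂ) (n : ℕ) (z : ℂ) : ℂ :=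
  ∑ k ∈ Finset.range (n + 1), taylorCoeff q s a c f k * Phi q a c k z

/-- The `n`th Taylor remainder `R_n^{(a,c)} f`. -/
def taylorRemainder (q s a c : ℂ) (f : ℂ → ℂ) (n : ℕ) (z : ℂ) : ℂ :=
  f z - taylorSum q s a c f n z

/-! ### The two-basis kernel -/

/-- The complementary basis `Ψ_k(z; b, c, d, e)`. -/
def Psi (q b c d e : ℂ) (k : ℕ) (z : ℂ) : ℂ :=
  (qPoch q (c * z / (d * e)) k * qPoch q (c / (d * e * z)) k) /
    (qPoch q (c ^ 2 * z / (b * d * e)) k * qPoch q (c ^ 2 / (b * d * e * z)) k)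

/-- The prefactor `A(z)`. -/
def prefA (q b c d e z : ℂ) : ℂ :=
  (qPochInf q (c * z / (d * e)) * qPochInf q (c / (d * e * z))) /
    (qPochInf q (c ^ 2 * z / (b * d * e)) * qPochInf q (c ^ 2 / (b * d * e * z)))

/-- The prefactor `B(z)`. -/
def prefB (q b c z : ℂ) : ℂ :=
  (qPochInf q (b * z) * qPochInf q (b / z)) / (qPochInf q (c * z) * qPochInf q (c / z))

/-- The normalized kernel `H(z)`. -/
def kernH (q c d e z : ℂ) : ℂ :=
  (qPochInf q (c * z / d) * qPochInf q (c / (d * z)) *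
      qPochInf q (c * z / e) * qPochInf q (c / (e * z))) /
    (qPochInf q (c * z) * qPochInf q (c / z) *
      qPochInf q (c * z / (d * e)) * qPochInf q (c / (d * e * z)))

/-- The normalized kernel `K(z)`. -/
def kernK (q b c d e z : ℂ) : ℂ :=
  (qPochInf q (c * z / d) * qPochInf q (c / (d * z)) *
      qPochInf q (c * z / e) * qPochInf q (c / (e * z))) /
    (qPochInf q (b * z) * qPochInf q (b / z) *
      qPochInf q (c ^ 2 * z / (b * d * e)) * qPochInf q (c ^ 2 / (b * d * e * z)))

/-- The coefficient `f_k`. -/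
def coeffF (q b c d e : ℂ) (k : ℕ) : ℂ :=
  (1 - b * c * q ^ (2 * k) / q) / (1 - b * c / q) *
    ((qPoch q (b * c / q) k * qPoch q d k * qPoch q e k * qPoch q (c ^ 2 / (d * e * q)) k) /
      (qPoch q q k * qPoch q (b * c / d) k * qPoch q (b * c / e) k *
        qPoch q (b * d * e * q / c) k)) * q ^ k

/-- The coefficient `g_k`. -/
def coeffG (q b c d e : ℂ) (k : ℕ) : ℂ :=
  (1 - c ^ 3 * q ^ (2 * k) / (b * d ^ 2 * e ^ 2 * q)) / (1 - c ^ 3 / (b * d ^ 2 * e ^ 2 * q)) *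
    ((qPoch q (c ^ 3 / (b * d ^ 2 * e ^ 2 * q)) k * qPoch q (c / (b * d)) k *
        qPoch q (c / (b * e)) k * qPoch q (c ^ 2 / (d * e * q)) k) /
      (qPoch q q k * qPoch q (c ^ 2 / (d * e ^ 2)) k * qPoch q (c ^ 2 / (d ^ 2 * e)) k *
        qPoch q (c * q / (b * d * e)) k)) * q ^ k

/-- Genericity of the parameters: the denominators that do not involve `z` are nonzero. -/
structure Generic (q b c d e : ℂ) : Prop where
  b_ne : b ≠ 0
  c_ne : c ≠ 0
  d_ne : d ≠ 0
  e_ne : e ≠ 0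
  -- the denominators of `H(b)` and `K(c/de)`
  reg_bc : QRegular q (b * c)
  reg_c_div_b : QRegular q (c / b)
  reg_bc_div_de : QRegular q (b * c / (d * e))
  reg_c_div_bde : QRegular q (c / (b * d * e))
  reg_bde_div_c : QRegular q (b * d * e / c)
  reg_c3 : QRegular q (c ^ 3 / (b * d ^ 2 * e ^ 2))
  -- the remaining denominators of `f_k` and `g_k`
  bc_ne_q : b * c ≠ q
  reg_bc_div_d : QRegular q (b * c / d)
  reg_bc_div_e : QRegular q (b * c / e)
  c3_ne_q : c ^ 3 / (b * d ^ 2 * e ^ 2) ≠ q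
  reg_c2_div_de2 : QRegular q (c ^ 2 / (d * e ^ 2))
  reg_c2_div_d2e : QRegular q (c ^ 2 / (d ^ 2 * e))
  -- together with the above: the grids `b q^m` and `(c/de) q^m` avoid the poles of `H` and `K`
  reg_b_div_c : QRegular q (b / c)
  -- `z - 1/z ≠ 0` at the points `b q^{i/2}` and `(c/de) q^{i/2}`, `i ≥ 1`, where the
  -- divided differences are taken
  grid_b : ∀ i : ℕ, 1 ≤ i → b ^ 2 * q ^ i ≠ 1
  grid_c_div_de : ∀ i : ℕ, 1 ≤ i → (c / (d * e)) ^ 2 * q ^ i ≠ 1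

/-- The points of `ℂ^*` off the pole sets of both bases `Φ_k` and `Ψ_k`. -/
def poleFree (q b c d e : ℂ) : Set ℂ :=
  {z | z ≠ 0 ∧ QRegular q (c * z) ∧ QRegular q (c / z) ∧
    QRegular q (c ^ 2 * z / (b * d * e)) ∧ QRegular q (c ^ 2 / (b * d * e * z))}

/-- The admissible points for the expansion of `A · R_n H`: off the pole sets, and off the
remaining denominator zeros of `H`. -/
def admissibleH (q b c d e : ℂ) : Set ℂ :=
  {z | z ∈ poleFree q b c d e ∧ QRegular q (c * z / (d * e)) ∧ QRegular q (c / (d * e * z))}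

/-- The admissible points for the expansion of `B · R_n K`: off the pole sets, and off the
remaining denominator zeros of `K`. -/
def admissibleK (q b c d e : ℂ) : Set ℂ :=
  {z | z ∈ poleFree q b c d e ∧ QRegular q (b * z) ∧ QRegular q (b / z)}

/-- The `(b,c)`-basis contribution `A(z) H(b) ∑_{k ≥ 0} f_k Φ_k(z; b, c)`. -/
def contribPhi (q b c d e z : ℂ) : ℂ :=
  prefA q b c d e z * kernH q c d e b * ∑' k : ℕ, coeffF q b c d e k * Phi q b c k z

/-- The complementary contribution `B(z) K(c/de) ∑_{k ≥ 0} g_k Ψ_k(z; b, c, d, e)`. -/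
def contribPsi (q b c d e z : ℂ) : ℂ :=
  prefB q b c z * kernK q b c d e (c / (d * e)) *
    ∑' k : ℕ, coeffG q b c d e k * Psi q b c d e k z

end

end WPTaylor

/-! Put `β = c/de`, `u = c/d`, `v = c/e`, `γ = c²/bde`, so that `c = uv/β` and `γ = uv/b`. Then `A·H
= (uz, u/z, vz, v/z; q)_∞ / (cz, c/z, γz, γ/z; q)_∞`, and everything rests on a two-term
nonterminating summation, cleared of denominators in `z`: `S(b,β) + S(β,b) = (uz, u/z, vz, v/z;
q)_∞` (`wpSeries_add_wpSeries`). Here `S` is `wpSeries`; its coefficients are `H(b) f_k`, and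
`K(c/de) g_k` once `b` and `β` are exchanged.

The summation comes from contiguity. Multiplying the series for `vq` by `(1-vz)(1-v/z)` gives the
series for `v` plus a boundary term that survives the limit (`tsum_wpTerm_shift`). The boundary
terms of the two series cancel (`shiftBoundary_antisymm`), so the total for `v` is `(1-vz)(1-v/z)`
times the total for `vq`. Iterating in `u` and `v` leaves a constant, the total at `u = v = 0`,
which depends only on `b`, `β`, `z`. At `u = β` one series vanishes and the other reduces to its
term `k = 0`, so the constant is `1`.

The Taylor side is algebraic. The well-poised operator sends the kernel `H` with parameters `(c, d,
e)` to a constant times the one with `(cq^{3/2}, dq, eq)` (`wpD_kernH`); hence the Taylor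
coefficients of `H` are exactly `H(b) f_k` (`taylorCoeff_kernH`). A Taylor sum is thus a partial sum
of the first series only, and the remainder is its tail plus the whole complementary series. The
tail is geometrically small, uniformly on compact sets.

The involution `(b, c, d, e) ↦ (c/de, c²/bde, c/be, c/bd)` exchanges `H` with `K`, `f` with `g` and
`A` with `B`, so each half of the theorem needs proof only once. For nonvanishing, at `z = b` only
the term `k = 0` survives; continuity and density carry this to an admissible point. -/

open Filter Topology

namespace WPTaylor

/-! ### Basic properties of `q`-shifted factorials -/

section Basic

variable {q : ℂ}

@[simp] lemma qPoch_zero (q x : ℂ) : qPoch q x 0 = 1 := by simp [qPoch]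

lemma qPoch_succ (q x : ℂ) (n : ℕ) : qPoch q x (n + 1) = qPoch q x n * (1 - x * q ^ n) := by
  simp [qPoch, Finset.prod_range_succ]

lemma qPoch_add (q x : ℂ) (m n : ℕ) :
    qPoch q x (m + n) = qPoch q x m * qPoch q (x * q ^ m) n := by
  simp only [qPoch, Finset.prod_range_add]
  congr 1
  exact Finset.prod_congr rfl fun j _ => by ring

lemma qPoch_succ' (q x : ℂ) (n : ℕ) : qPoch q x (n + 1) = (1 - x) * qPoch q (x * q) n := by
  rw [add_comm, qPoch_add]
  simp [qPoch]

lemma qPoch_one_left (q : ℂ) (n : ℕ) : qPoch q 1 (n + 1) = 0 := by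
  rw [qPoch_succ']; simp

lemma qPoch_ne_zero {x : ℂ} (hx : QRegular q x) (n : ℕ) : qPoch q x n ≠ 0 :=
  Finset.prod_ne_zero_iff.2 fun j _ => sub_ne_zero.2 (hx j).symm

lemma QRegular.shift {x : ℂ} (hx : QRegular q x) (n : ℕ) : QRegular q (x * q ^ n) := fun m => by
  rw [mul_assoc, ← pow_add]; exact hx _

lemma QRegular.mul_q {x : ℂ} (hx : QRegular q x) : QRegular q (x * q) := by
  simpa using hx.shift 1

lemma QRegular.one_sub_ne_zero {x : ℂ} (hx : QRegular q x) (n : ℕ) : 1 - x * q ^ n ≠ 0 :=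
  sub_ne_zero.2 (hx n).symm

lemma QRegular.one_sub_ne_zero' {x : ℂ} (hx : QRegular q x) : 1 - x ≠ 0 := by
  simpa using hx.one_sub_ne_zero 0

lemma QRegular.of_norm_lt_one (hq1 : ‖q‖ < 1) {x : ℂ} (hx : ‖x‖ < 1) : QRegular q x := by
  intro m h
  have h1 : ‖x * q ^ m‖ = 1 := by rw [h, norm_one]
  rw [norm_mul, norm_pow] at h1
  have h2 : ‖q‖ ^ m ≤ 1 := pow_le_one₀ (norm_nonneg _) hq1.le
  nlinarith [norm_nonneg x]

lemma summable_norm_qfactor (hq1 : ‖q‖ < 1) (x : ℂ) : Summable fun j : ℕ => ‖-(x * q ^ j)‖ := by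
  simp only [norm_neg, norm_mul, norm_pow]
  exact (summable_geometric_of_lt_one (norm_nonneg _) hq1).mul_left _

lemma multipliable_qfactor (hq1 : ‖q‖ < 1) (x : ℂ) :
    Multipliable fun j : ℕ => (1 - x * q ^ j) := by
  simpa only [sub_eq_add_neg] using multipliable_one_add_of_summable (summable_norm_qfactor hq1 x)

lemma tendsto_qPoch (hq1 : ‖q‖ < 1) (x : ℂ) :
    Tendsto (qPoch q x) atTop (𝓝 (qPochInf q x)) :=
  (multipliable_qfactor hq1 x).tendsto_prod_tprod_nat

lemma qPochInf_eq_mul (hq1 : ‖q‖ < 1) (x : ℂ) (n : ℕ) :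
    qPochInf q x = qPoch q x n * qPochInf q (x * q ^ n) := by
  have h1 : Tendsto (fun m => qPoch q x (n + m)) atTop (𝓝 (qPochInf q x)) := by
    simpa only [add_comm] using (tendsto_add_atTop_iff_nat n).2 (tendsto_qPoch hq1 x)
  have h2 := (tendsto_qPoch hq1 (x * q ^ n)).const_mul (qPoch q x n)
  simp only [qPoch_add] at h1
  exact tendsto_nhds_unique h1 h2

lemma qPochInf_eq_one_sub_mul (hq1 : ‖q‖ < 1) (x : ℂ) :
    qPochInf q x = (1 - x) * qPochInf q (x * q) := by
  simpa [qPoch] using qPochInf_eq_mul hq1 x 1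

lemma qPochInf_one (hq1 : ‖q‖ < 1) : qPochInf q 1 = 0 := by
  rw [qPochInf_eq_one_sub_mul hq1]; simp

lemma qPochInf_ne_zero (hq1 : ‖q‖ < 1) {x : ℂ} (hx : QRegular q x) : qPochInf q x ≠ 0 := by
  have := tprod_one_add_ne_zero_of_summable (f := fun j : ℕ => -(x * q ^ j))
    (fun j => by simpa only [← sub_eq_add_neg] using hx.one_sub_ne_zero j)
    (summable_norm_qfactor hq1 x)
  simp only [← sub_eq_add_neg] at this
  exact this

/-! ### Uniform bounds for shifted factorials, above and below -/

lemma norm_qPoch_le (hq1 : ‖q‖ < 1) {x : ℂ} {R : ℝ} (hx : ‖x‖ ≤ R) (n : ℕ) :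
    ‖qPoch q x n‖ ≤ Real.exp (R / (1 - ‖q‖)) := by
  have hR : 0 ≤ R := (norm_nonneg x).trans hx
  calc ‖qPoch q x n‖ = ∏ j ∈ Finset.range n, ‖1 - x * q ^ j‖ := by rw [qPoch, norm_prod]
    _ ≤ ∏ j ∈ Finset.range n, Real.exp (R * ‖q‖ ^ j) := by
        refine Finset.prod_le_prod (fun _ _ => norm_nonneg _) fun j _ => ?_
        calc ‖1 - x * q ^ j‖ ≤ ‖(1 : ℂ)‖ + ‖x * q ^ j‖ := norm_sub_le _ _
          _ = ‖x‖ * ‖q‖ ^ j + 1 := by rw [norm_one, norm_mul, norm_pow, add_comm]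
          _ ≤ R * ‖q‖ ^ j + 1 := by gcongr
          _ ≤ _ := Real.add_one_le_exp _
    _ = Real.exp (R * ∑ j ∈ Finset.range n, ‖q‖ ^ j) := by
        rw [← Real.exp_sum, Finset.mul_sum]
    _ ≤ _ := by
        rw [Real.exp_le_exp, div_eq_mul_inv]
        gcongr
        rw [← tsum_geometric_of_lt_one (norm_nonneg _) hq1]
        exact (summable_geometric_of_lt_one (norm_nonneg _) hq1).sum_le_tsum _
          fun _ _ => by positivity

lemma norm_qPochInf_le (hq1 : ‖q‖ < 1) {x : ℂ} {R : ℝ} (hx : ‖x‖ ≤ R) :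
    ‖qPochInf q x‖ ≤ Real.exp (R / (1 - ‖q‖)) :=
  le_of_tendsto (tendsto_qPoch hq1 x).norm (Eventually.of_forall fun n => norm_qPoch_le hq1 hx n)

lemma continuous_qPoch (q : ℂ) (n : ℕ) : Continuous fun x => qPoch q x n := by
  unfold qPoch; fun_prop

@[fun_prop]
lemma _root_.Continuous.qPoch {X : Type*} [TopologicalSpace X] {f : X → ℂ} (hf : Continuous f)
    (q : ℂ) (n : ℕ) : Continuous fun x => qPoch q (f x) n :=
  (continuous_qPoch q n).comp hf

lemma continuous_qPochInf (hq1 : ‖q‖ < 1) : Continuous (qPochInf q) := by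
  rw [continuous_iff_continuousAt]
  intro x
  have h := tendsto_tprod_one_add_of_dominated_convergence (𝓕 := 𝓝 x)
    (f := fun (y : ℂ) (j : ℕ) => -(y * q ^ j)) (g := fun j => -(x * q ^ j))
    (bound := fun j => (‖x‖ + 1) * ‖q‖ ^ j)
    ((summable_geometric_of_lt_one (norm_nonneg _) hq1).mul_left _)
    (fun j => by
      have : Continuous fun y : ℂ => -(y * q ^ j) := by fun_prop
      exact this.tendsto x)
    (by
      filter_upwards [Metric.ball_mem_nhds x one_pos] with y hy j
      rw [norm_neg, norm_mul, norm_pow]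
      gcongr
      have : ‖y - x‖ < 1 := by simpa [dist_eq_norm] using hy
      have h2 := norm_add_le (y - x) x
      rw [sub_add_cancel] at h2
      linarith)
  simp only [← sub_eq_add_neg] at h
  exact h

lemma qPochInf_zero (q : ℂ) : qPochInf q 0 = 1 := by simp [qPochInf]

lemma norm_mul_pow_le (hq1 : ‖q‖ < 1) {x : ℂ} {R : ℝ} (hx : ‖x‖ ≤ R) (m : ℕ) :
    ‖x * q ^ m‖ ≤ R := by
  rw [norm_mul, norm_pow]
  exact (mul_le_of_le_one_right (norm_nonneg _) (pow_le_one₀ (norm_nonneg _) hq1.le)).trans hx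

/-- On a compact set of regular points, finite shifted factorials are uniformly bounded below. -/
lemma exists_le_norm_qPoch (hq1 : ‖q‖ < 1) {L : Set ℂ} (hL : IsCompact L)
    (hreg : ∀ x ∈ L, QRegular q x) :
    ∃ δ > 0, ∀ x ∈ L, ∀ m k : ℕ, δ ≤ ‖qPoch q (x * q ^ m) k‖ := by
  rcases L.eq_empty_or_nonempty with rfl | hne
  · exact ⟨1, one_pos, by simp⟩
  obtain ⟨R, hR⟩ := hL.isBounded.exists_norm_le
  obtain ⟨x₀, hx₀, hmin⟩ := hL.exists_isMinOn hne (continuous_qPochInf hq1).norm.continuousOn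
  have h0 : 0 < ‖qPochInf q x₀‖ := norm_pos_iff.2 (qPochInf_ne_zero hq1 (hreg _ hx₀))
  set M := Real.exp (R / (1 - ‖q‖)) with hM
  have hMpos : 0 < M := Real.exp_pos _
  -- In `(x)_∞ = (x)_m (xq^m)_k (xq^{m+k})_∞` the two outer factors are at most `M` each, which
  -- bounds the middle one below.
  refine ⟨‖qPochInf q x₀‖ / (M * M), by positivity, fun x hx m k => ?_⟩
  rw [div_le_iff₀ (by positivity)]
  have h1 : ‖qPochInf q x₀‖ ≤ ‖qPochInf q x‖ := hmin hx
  refine h1.trans ?_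
  rw [qPochInf_eq_mul hq1 x m, qPochInf_eq_mul hq1 (x * q ^ m) k, norm_mul, norm_mul]
  have h2 := norm_qPoch_le hq1 (hR x hx) m
  have h3 := norm_qPochInf_le hq1 (norm_mul_pow_le hq1 (norm_mul_pow_le hq1 (hR x hx) m) k)
  calc _ ≤ M * (‖qPoch q (x * q ^ m) k‖ * M) := by gcongr
    _ = _ := by ring

lemma exists_le_norm_qPoch_of_qRegular (hq1 : ‖q‖ < 1) {x : ℂ} (hx : QRegular q x) :
    ∃ δ > 0, ∀ m k : ℕ, δ ≤ ‖qPoch q (x * q ^ m) k‖ := by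
  obtain ⟨δ, hδ, h⟩ := exists_le_norm_qPoch hq1 (isCompact_singleton (x := x)) (by simpa using hx)
  exact ⟨δ, hδ, h x rfl⟩

lemma exists_le_norm_qPochInf_of_qRegular (hq1 : ‖q‖ < 1) {x : ℂ} (hx : QRegular q x) :
    ∃ δ > 0, ∀ m : ℕ, δ ≤ ‖qPochInf q (x * q ^ m)‖ := by
  obtain ⟨δ, hδ, h⟩ := exists_le_norm_qPoch_of_qRegular hq1 hx
  exact ⟨δ, hδ, fun m => ge_of_tendsto (tendsto_qPoch hq1 (x * q ^ m)).norm
    (Eventually.of_forall fun k => h m k)⟩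

lemma qRegular_self (hq1 : ‖q‖ < 1) : QRegular q q := .of_norm_lt_one hq1 hq1

end Basic

/-! ### Contiguity of the two-basis series under `v ↦ vq` -/

section Contiguity

variable {q b β u v z : ℂ}

/-- The coefficient of the two-basis expansion in the parameters `b, β = c/de, u = c/d, v = c/e`,
without its factor `q ^ k`. -/
noncomputable def wpRatio (q b β u v : ℂ) (k : ℕ) : ℂ :=
  qPochInf q (u * b * q ^ k) * qPochInf q (v * b * q ^ k) * qPochInf q (u / b) *
      qPochInf q (v / b) * (1 - b * (u * v / β) / q * q ^ (2 * k)) *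
      (qPoch q (v / β) k * qPoch q (u / β) k * qPoch q (u * v / q) k) /
    (qPochInf q (b * (u * v / β) / q * q ^ k) * qPochInf q (u * v / (b * β)) *
      qPochInf q (b * β) * qPochInf q (β / b) * (qPoch q q k * qPoch q (b / β * q) k))

/-- The well-poised monomial cleared of its denominator. -/
noncomputable def wpTerm (q b c z : ℂ) (k : ℕ) : ℂ :=
  qPoch q (b * z) k * qPoch q (b / z) k * (qPochInf q (c * z * q ^ k) * qPochInf q (c / z * q ^ k))

/-- One of the two series of the expansion, cleared of denominators in `z`. -/
noncomputable def wpSeries (q b β u v z : ℂ) : ℂ :=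
  qPochInf q (β * z) * qPochInf q (β / z) *
    ∑' k : ℕ, wpRatio q b β u v k * q ^ k * wpTerm q b (u * v / β) z k

/-- Regularity of the parameters `b, β, u, v`. -/
structure WPRegular (q b β u v : ℂ) : Prop where
  b_ne : b ≠ 0
  β_ne : β ≠ 0
  u_ne : u ≠ 0
  v_ne : v ≠ 0
  reg_bβ : QRegular q (b * β)
  reg_b_div_β : QRegular q (b / β)
  reg_β_div_b : QRegular q (β / b)
  reg_c_div_b : QRegular q (u * v / (b * β))
  reg_bc : QRegular q (b * (u * v / β) / q)
  reg_βγ : QRegular q (β * (u * v / b) / q)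

lemma WPRegular.symm (h : WPRegular q b β u v) : WPRegular q β b u v where
  b_ne := h.β_ne
  β_ne := h.b_ne
  u_ne := h.u_ne
  v_ne := h.v_ne
  reg_bβ := by simpa only [mul_comm] using h.reg_bβ
  reg_b_div_β := h.reg_β_div_b
  reg_β_div_b := h.reg_b_div_β
  reg_c_div_b := by rw [mul_comm β b]; exact h.reg_c_div_b
  reg_bc := h.reg_βγ
  reg_βγ := h.reg_bc

lemma WPRegular.swap (h : WPRegular q b β u v) : WPRegular q b β v u where
  b_ne := h.b_ne
  β_ne := h.β_ne
  u_ne := h.v_ne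
  v_ne := h.u_ne
  reg_bβ := h.reg_bβ
  reg_b_div_β := h.reg_b_div_β
  reg_β_div_b := h.reg_β_div_b
  reg_c_div_b := by rw [mul_comm v u]; exact h.reg_c_div_b
  reg_bc := by rw [mul_comm v u]; exact h.reg_bc
  reg_βγ := by rw [mul_comm v u]; exact h.reg_βγ

lemma WPRegular.mul_q (hq0 : q ≠ 0) (h : WPRegular q b β u v) : WPRegular q b β u (v * q) where
  b_ne := h.b_ne
  β_ne := h.β_ne
  u_ne := h.u_ne
  v_ne := mul_ne_zero h.v_ne hq0
  reg_bβ := h.reg_bβ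
  reg_b_div_β := h.reg_b_div_β
  reg_β_div_b := h.reg_β_div_b
  reg_c_div_b := by convert h.reg_c_div_b.mul_q using 1; ring
  reg_bc := by convert h.reg_bc.mul_q using 1; ring
  reg_βγ := by convert h.reg_βγ.mul_q using 1; ring

lemma WPRegular.mul_pow (hq0 : q ≠ 0) (h : WPRegular q b β u v) (N : ℕ) :
    WPRegular q b β (u * q ^ N) (v * q ^ N) := by
  induction N with
  | zero => simpa using h
  | succ N ih =>
    have := ((ih.mul_q hq0).swap.mul_q hq0).swap
    simpa only [pow_succ, mul_assoc] using this

lemma wpRatio_swap (q b β u v : ℂ) (k : ℕ) : wpRatio q b β u v k = wpRatio q b β v u k := by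
  simp only [wpRatio, mul_comm v u]
  ring

lemma wpSeries_swap (q b β u v z : ℂ) : wpSeries q b β u v z = wpSeries q b β v u z := by
  simp only [wpSeries, wpRatio_swap q b β u v, mul_comm v u]

/-- The expansion coefficient of the quadratic factor on the next monomial, times `q ^ k`. -/
noncomputable def shiftUp (q b β u v : ℂ) (k : ℕ) : ℂ :=
  (1 - v * (u * v / β) * q ^ k) * (v / b - u * v / (b * β) * q ^ k) /
    ((1 - b * (u * v / β) * q ^ (2 * k)) * (1 - u * v / (b * β)))

/-- The expansion coefficient of the quadratic factor on the same monomial, times `q ^ k`. -/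
noncomputable def shiftSame (q b β u v : ℂ) (k : ℕ) : ℂ :=
  (1 - v * b * q ^ k) * (q ^ k - v / b) /
    ((1 - b * (u * v / β) * q ^ (2 * k)) * (1 - u * v / (b * β)))

lemma WPRegular.one_sub_bc_ne (hq0 : q ≠ 0) (h : WPRegular q b β u v) (k : ℕ) :
    1 - b * (u * v / β) * q ^ k ≠ 0 := by
  convert h.reg_bc.one_sub_ne_zero (k + 1) using 1
  rw [pow_succ]
  field_simp

/-- Products `(1-xz)(1-x/z)` are affine in `z + 1/z`, so the one with `x = v` is a combination of
those with `x = bq^k` and `x = cq^k`. The first advances the monomial to `k + 1`. The second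
restores the factors lost because `v ↦ vq` forces `c ↦ cq`. -/
lemma mul_wpTerm_shift (hq0 : q ≠ 0) (hq1 : ‖q‖ < 1) (hz : z ≠ 0) (h : WPRegular q b β u v)
    (k : ℕ) :
    q ^ k * ((1 - v * z) * (1 - v / z) * wpTerm q b (u * (v * q) / β) z k) =
      shiftUp q b β u v k * wpTerm q b (u * v / β) z (k + 1) +
        shiftSame q b β u v k * wpTerm q b (u * v / β) z k := by
  have hb := h.b_ne; have hβ := h.β_ne; have hu := h.u_ne; have hv := h.v_ne
  have h1 := h.one_sub_bc_ne hq0 (2 * k)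
  have h3 := h.reg_c_div_b.one_sub_ne_zero'
  have e1 : qPochInf q (u * v / β * z * q ^ k) =
      (1 - u * v / β * z * q ^ k) * qPochInf q (u * v / β * z * q ^ (k + 1)) := by
    rw [qPochInf_eq_one_sub_mul hq1, pow_succ]; ring_nf
  have e2 : qPochInf q (u * v / β / z * q ^ k) =
      (1 - u * v / β / z * q ^ k) * qPochInf q (u * v / β / z * q ^ (k + 1)) := by
    rw [qPochInf_eq_one_sub_mul hq1, pow_succ]; ring_nf
  have e3 : u * (v * q) / β * z * q ^ k = u * v / β * z * q ^ (k + 1) := by ring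
  have e4 : u * (v * q) / β / z * q ^ k = u * v / β / z * q ^ (k + 1) := by ring
  have key : q ^ k * ((1 - v * z) * (1 - v / z)) =
      shiftUp q b β u v k * ((1 - b * z * q ^ k) * (1 - b / z * q ^ k)) +
      shiftSame q b β u v k * ((1 - u * v / β * z * q ^ k) * (1 - u * v / β / z * q ^ k)) := by
    unfold shiftUp shiftSame
    rw [pow_mul' q 2 k] at h1 ⊢
    generalize q ^ k = x at *
    obtain ⟨D, hD⟩ : ∃ D, D = (1 - b * (u * v / β) * x ^ 2) * (1 - u * v / (b * β)) := ⟨_, rfl⟩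
    have hD0 : D ≠ 0 := hD ▸ mul_ne_zero h1 h3
    rw [← hD]
    field_simp
    rw [hD]
    field_simp
    ring
  simp only [wpTerm, qPoch_succ, e3, e4, e1, e2]
  linear_combination (qPoch q (b * z) k * qPoch q (b / z) k *
    (qPochInf q (u * v / β * z * q ^ (k + 1)) * qPochInf q (u * v / β / z * q ^ (k + 1)))) * key

lemma wpRatio_shift_zero (hq0 : q ≠ 0) (hq1 : ‖q‖ < 1) (h : WPRegular q b β u v) :
    wpRatio q b β u v 0 = shiftSame q b β u v 0 * wpRatio q b β u (v * q) 0 := by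
  have hb := h.b_ne; have hβ := h.β_ne; have hu := h.u_ne; have hv := h.v_ne
  have h1 := h.one_sub_bc_ne hq0 0
  have h2 := h.reg_bc.one_sub_ne_zero'
  have h3 := h.reg_c_div_b.one_sub_ne_zero'
  have e1 : qPochInf q (v * b) = (1 - v * b) * qPochInf q (v * q * b) := by
    rw [qPochInf_eq_one_sub_mul hq1]; ring_nf
  have e2 : qPochInf q (v / b) = (1 - v / b) * qPochInf q (v * q / b) := by
    rw [qPochInf_eq_one_sub_mul hq1]; ring_nf
  have e3 : qPochInf q (b * (u * v / β) / q) = (1 - b * (u * v / β) / q) *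
      ((1 - b * (u * v / β)) * qPochInf q (b * (u * v / β) * q)) := by
    rw [qPochInf_eq_one_sub_mul hq1, div_mul_cancel₀ _ hq0, ← qPochInf_eq_one_sub_mul hq1]
  have e4 : qPochInf q (u * v / (b * β)) =
      (1 - u * v / (b * β)) * qPochInf q (u * (v * q) / (b * β)) := by
    rw [qPochInf_eq_one_sub_mul hq1]; ring_nf
  have e5 : qPochInf q (b * (u * (v * q) / β) / q) =
      (1 - b * (u * v / β)) * qPochInf q (b * (u * v / β) * q) := by
    rw [← qPochInf_eq_one_sub_mul hq1]; congr 1; field_simp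
  have e6 : b * (u * (v * q) / β) / q = b * (u * v / β) := by field_simp
  have n1 : qPochInf q (b * (u * v / β) * q) ≠ 0 := by
    apply qPochInf_ne_zero hq1
    convert h.reg_bc.shift 2 using 1; field_simp
  have n2 : qPochInf q (u * (v * q) / (b * β)) ≠ 0 := qPochInf_ne_zero hq1 (h.mul_q hq0).reg_c_div_b
  have n3 := qPochInf_ne_zero hq1 h.reg_bβ
  have n4 := qPochInf_ne_zero hq1 h.reg_β_div_b
  simp only [wpRatio, shiftSame, pow_zero, mul_one, qPoch_zero, mul_zero, e1, e2, e3, e4, e5]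
  rw [e6]
  rw [pow_zero, mul_one] at h1
  rw [div_mul_div_comm, div_eq_div_iff]
  · ring
  · simp only [ne_eq, mul_eq_zero, not_or]; tauto
  · simp only [ne_eq, mul_eq_zero, not_or]; tauto

/-- The rational identity behind the recurrence `wpRatio_shift_succ`, with `x` in the role of `q ^
m`. -/
lemma shift_identity {x : ℂ} (hq0 : q ≠ 0) (hb : b ≠ 0) (hβ : β ≠ 0)
    (h0 : 1 - b * (u * v / β) * x ≠ 0) (h0' : 1 - b * (u * v / β) * (x * q) ≠ 0)
    (h1 : 1 - b * (u * v / β) * x ^ 2 ≠ 0) (h1' : 1 - b * (u * v / β) * (x * q) ^ 2 ≠ 0)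
    (h2 : 1 - u * v / (b * β) ≠ 0) (h3 : 1 - q * x ≠ 0) (h4 : 1 - b / β * q * x ≠ 0) :
    (1 - v * b * (x * q)) * (1 - v / b) * (1 - b * (u * v / β) / q * (x * q) ^ 2) *
          ((1 - v / β) * (1 - u / β * x) * (1 - u * v / q)) /
        ((1 - b * (u * v / β) * x) * (1 - b * (u * v / β) * (x * q)) * (1 - u * v / (b * β)) *
          ((1 - q * x) * (1 - b / β * q * x))) * (x * q) =
      (1 - v * (u * v / β) * x) * (v / b - u * v / (b * β) * x) /
          ((1 - b * (u * v / β) * x ^ 2) * (1 - u * v / (b * β))) *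
        ((1 - u * b * x) * (1 - v * b * (x * q)) * (1 - b * (u * (v * q) / β) / q * x ^ 2) /
          ((1 - b * (u * v / β) * x) * (1 - b * (u * v / β) * (x * q)))) +
      (1 - v * b * (x * q)) * (x * q - v / b) /
          ((1 - b * (u * v / β) * (x * q) ^ 2) * (1 - u * v / (b * β))) *
        ((1 - b * (u * (v * q) / β) / q * (x * q) ^ 2) *
          ((1 - v * q / β * x) * (1 - u / β * x) * (1 - u * (v * q) / q * x)) /
          ((1 - b * (u * v / β) * (x * q)) * ((1 - q * x) * (1 - b / β * q * x)))) := by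
  have e : u * (v * q) / q = u * v := by field_simp
  have e' : b * (u * (v * q) / β) / q = b * (u * v / β) := by field_simp
  rw [e, e']
  -- The denominators stay opaque while fractions are cleared; only `D0`, `D3`, `D4` have to be
  -- expanded afterwards, the others cancel.
  obtain ⟨D0, hD0⟩ : ∃ D, D = 1 - b * (u * v / β) * x := ⟨_, rfl⟩
  obtain ⟨D0', hD0'⟩ : ∃ D, D = 1 - b * (u * v / β) * (x * q) := ⟨_, rfl⟩
  obtain ⟨D1, hD1⟩ : ∃ D, D = 1 - b * (u * v / β) * x ^ 2 := ⟨_, rfl⟩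
  obtain ⟨D1', hD1'⟩ : ∃ D, D = 1 - b * (u * v / β) * (x * q) ^ 2 := ⟨_, rfl⟩
  obtain ⟨D2, hD2⟩ : ∃ D, D = 1 - u * v / (b * β) := ⟨_, rfl⟩
  obtain ⟨D3, hD3⟩ : ∃ D, D = 1 - q * x := ⟨_, rfl⟩
  obtain ⟨D4, hD4⟩ : ∃ D, D = 1 - b / β * q * x := ⟨_, rfl⟩
  rw [← hD0] at h0 ⊢
  rw [← hD0'] at h0' ⊢
  rw [← hD1] at h1 ⊢
  rw [← hD1'] at h1' ⊢
  rw [← hD2] at h2 ⊢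
  rw [← hD3] at h3 ⊢
  rw [← hD4] at h4 ⊢
  field_simp
  rw [hD0, hD3, hD4]
  field_simp
  ring

/-- The monomial of index `m + 1` receives one contribution from index `m` and one from its own
index; this compares its coefficients. -/
lemma wpRatio_shift_succ (hq0 : q ≠ 0) (hq1 : ‖q‖ < 1) (h : WPRegular q b β u v) (m : ℕ) :
    wpRatio q b β u v (m + 1) * q ^ (m + 1) =
      shiftUp q b β u v m * wpRatio q b β u (v * q) m +
        shiftSame q b β u v (m + 1) * wpRatio q b β u (v * q) (m + 1) := by
  have hb := h.b_ne; have hβ := h.β_ne; have hu := h.u_ne; have hv := h.v_ne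
  have h0 := h.one_sub_bc_ne hq0 m
  have h0' := h.one_sub_bc_ne hq0 (m + 1)
  have h1 := h.one_sub_bc_ne hq0 (2 * m)
  have h1' := h.one_sub_bc_ne hq0 (2 * (m + 1))
  have h3 : 1 - q * q ^ m ≠ 0 := (qRegular_self hq1).one_sub_ne_zero m
  have h4 : 1 - b / β * q * q ^ m ≠ 0 := h.reg_b_div_β.mul_q.one_sub_ne_zero m
  have e1 : qPochInf q (u * b * q ^ m) =
      (1 - u * b * q ^ m) * qPochInf q (u * b * q ^ (m + 1)) := by
    rw [qPochInf_eq_one_sub_mul hq1]; ring_nf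
  have e2 : qPochInf q (v * b * q ^ (m + 1)) =
      (1 - v * b * q ^ (m + 1)) * qPochInf q (v * q * b * q ^ (m + 1)) := by
    rw [qPochInf_eq_one_sub_mul hq1]; ring_nf
  have e2' : qPochInf q (v * q * b * q ^ m) =
      (1 - v * b * q ^ (m + 1)) * qPochInf q (v * q * b * q ^ (m + 1)) := by
    rw [qPochInf_eq_one_sub_mul hq1]; ring_nf
  have e3 : qPochInf q (v / b) = (1 - v / b) * qPochInf q (v * q / b) := by
    rw [qPochInf_eq_one_sub_mul hq1]; ring_nf
  have e4' : qPochInf q (b * (u * (v * q) / β) / q * q ^ (m + 1)) =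
      (1 - b * (u * v / β) * q ^ (m + 1)) * qPochInf q (b * (u * v / β) * q ^ (m + 2)) := by
    have a : b * (u * (v * q) / β) / q * q ^ (m + 1) = b * (u * v / β) * q ^ (m + 1) := by
      field_simp
    rw [a, qPochInf_eq_one_sub_mul hq1]; ring_nf
  have e4 : qPochInf q (b * (u * v / β) / q * q ^ (m + 1)) = (1 - b * (u * v / β) * q ^ m) *
      ((1 - b * (u * v / β) * q ^ (m + 1)) * qPochInf q (b * (u * v / β) * q ^ (m + 2))) := by
    have a : b * (u * v / β) / q * q ^ (m + 1) = b * (u * v / β) * q ^ m := by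
      rw [pow_succ]; field_simp
    rw [a, qPochInf_eq_one_sub_mul hq1, ← e4']
    congr 2; rw [pow_succ]; field_simp
  have e4'' : qPochInf q (b * (u * (v * q) / β) / q * q ^ m) = (1 - b * (u * v / β) * q ^ m) *
      ((1 - b * (u * v / β) * q ^ (m + 1)) * qPochInf q (b * (u * v / β) * q ^ (m + 2))) := by
    rw [← e4]; congr 1; rw [pow_succ]; field_simp
  have e5 : qPochInf q (u * v / (b * β)) =
      (1 - u * v / (b * β)) * qPochInf q (u * (v * q) / (b * β)) := by
    rw [qPochInf_eq_one_sub_mul hq1]; ring_nf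
  have e6 : qPoch q (v / β) (m + 1) = (1 - v / β) * qPoch q (v * q / β) m := by
    rw [qPoch_succ']; ring_nf
  have e7 : qPoch q (u * v / q) (m + 1) = (1 - u * v / q) * qPoch q (u * (v * q) / q) m := by
    rw [qPoch_succ']; ring_nf
  have key := shift_identity (x := q ^ m) (u := u) (v := v) hq0 hb hβ h0 (pow_succ q m ▸ h0')
    (pow_mul' q 2 m ▸ h1) (pow_succ q m ▸ pow_mul' q 2 (m + 1) ▸ h1')
    h.reg_c_div_b.one_sub_ne_zero' h3 h4
  simp only [← pow_succ, ← pow_mul'] at key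
  -- `G` collects the factors common to the three coefficients, so that only rational functions of
  -- `q ^ m` remain.
  set G : ℂ := qPochInf q (u * b * q ^ (m + 1)) * qPochInf q (v * q * b * q ^ (m + 1)) *
      qPochInf q (u / b) * qPochInf q (v * q / b) * (qPoch q (v * q / β) m * qPoch q (u / β) m *
      qPoch q (u * (v * q) / q) m) / (qPochInf q (b * (u * v / β) * q ^ (m + 2)) *
      qPochInf q (u * (v * q) / (b * β)) * qPochInf q (b * β) * qPochInf q (β / b) *
      (qPoch q q m * qPoch q (b / β * q) m)) with hG
  have r1 : wpRatio q b β u v (m + 1) = G * ((1 - v * b * q ^ (m + 1)) * (1 - v / b) *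
      (1 - b * (u * v / β) / q * q ^ (2 * (m + 1))) *
      ((1 - v / β) * (1 - u / β * q ^ m) * (1 - u * v / q)) /
      ((1 - b * (u * v / β) * q ^ m) * (1 - b * (u * v / β) * q ^ (m + 1)) *
        (1 - u * v / (b * β)) * ((1 - q * q ^ m) * (1 - b / β * q * q ^ m)))) := by
    simp only [wpRatio, e2, e3, e4, e5, e6, e7, hG]
    simp only [qPoch_succ]
    rw [div_mul_div_comm]
    congr 1 <;> ring
  have r2 : wpRatio q b β u (v * q) m = G * ((1 - u * b * q ^ m) * (1 - v * b * q ^ (m + 1)) *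
      (1 - b * (u * (v * q) / β) / q * q ^ (2 * m)) /
      ((1 - b * (u * v / β) * q ^ m) * (1 - b * (u * v / β) * q ^ (m + 1)))) := by
    simp only [wpRatio, e1, e2', e4'', hG]
    rw [div_mul_div_comm]
    congr 1 <;> ring
  have r3 : wpRatio q b β u (v * q) (m + 1) = G * ((1 - b * (u * (v * q) / β) / q *
      q ^ (2 * (m + 1))) *
      ((1 - v * q / β * q ^ m) * (1 - u / β * q ^ m) * (1 - u * (v * q) / q * q ^ m)) /
      ((1 - b * (u * v / β) * q ^ (m + 1)) * ((1 - q * q ^ m) * (1 - b / β * q * q ^ m)))) := by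
    simp only [wpRatio, e4', hG]
    simp only [qPoch_succ]
    rw [div_mul_div_comm]
    congr 1 <;> ring
  rw [r1, r2, r3]
  simp only [shiftUp, shiftSame]
  linear_combination G * key

end Contiguity

/-! ### Uniformly bounded families -/

/-- A family of complex numbers is uniformly bounded. -/
def UnifBdd {ι : Type*} (F : ι → ℂ) : Prop := ∃ C : ℝ, ∀ i, ‖F i‖ ≤ C

section Bounded

variable {ι : Type*} {F G : ι → ℂ} {q : ℂ}

lemma UnifBdd.mul (hF : UnifBdd F) (hG : UnifBdd G) : UnifBdd fun i => F i * G i := by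
  obtain ⟨C, hC⟩ := hF
  obtain ⟨D, hD⟩ := hG
  refine ⟨C * D, fun i => ?_⟩
  rw [norm_mul]
  exact mul_le_mul (hC i) (hD i) (norm_nonneg _) ((norm_nonneg _).trans (hC i))

lemma unifBdd_const (a : ℂ) : UnifBdd fun _ : ι => a := ⟨‖a‖, fun _ => le_rfl⟩

lemma UnifBdd.sub (hF : UnifBdd F) (hG : UnifBdd G) : UnifBdd fun i => F i - G i := by
  obtain ⟨C, hC⟩ := hF
  obtain ⟨D, hD⟩ := hG
  exact ⟨C + D, fun i => (norm_sub_le _ _).trans (add_le_add (hC i) (hD i))⟩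

lemma unifBdd_inv_of_le {δ : ℝ} (hδ : 0 < δ) (h : ∀ i, δ ≤ ‖F i‖) : UnifBdd fun i => (F i)⁻¹ :=
  ⟨δ⁻¹, fun i => by rw [norm_inv]; exact inv_anti₀ hδ (h i)⟩

lemma unifBdd_mul_pow (hq1 : ‖q‖ < 1) (x : ℂ) (m : ι → ℕ) : UnifBdd fun i => x * q ^ m i :=
  ⟨‖x‖, fun _ => norm_mul_pow_le hq1 le_rfl _⟩

lemma UnifBdd.qPoch (hq1 : ‖q‖ < 1) (hF : UnifBdd F) (n : ι → ℕ) :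
    UnifBdd fun i => qPoch q (F i) (n i) := by
  obtain ⟨C, hC⟩ := hF
  exact ⟨_, fun i => norm_qPoch_le hq1 (hC i) _⟩

lemma UnifBdd.qPochInf (hq1 : ‖q‖ < 1) (hF : UnifBdd F) : UnifBdd fun i => qPochInf q (F i) := by
  obtain ⟨C, hC⟩ := hF
  exact ⟨_, fun i => norm_qPochInf_le hq1 (hC i)⟩

lemma unifBdd_inv_qPoch (hq1 : ‖q‖ < 1) {x : ℂ} (hx : QRegular q x) (n : ι → ℕ) :
    UnifBdd fun i => (qPoch q x (n i))⁻¹ := by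
  obtain ⟨δ, hδ, h⟩ := exists_le_norm_qPoch_of_qRegular hq1 hx
  exact unifBdd_inv_of_le hδ fun i => by simpa using h 0 (n i)

lemma unifBdd_inv_qPochInf (hq1 : ‖q‖ < 1) {x : ℂ} (hx : QRegular q x) (m : ι → ℕ)
    (hF : ∀ i, F i = x * q ^ m i) : UnifBdd fun i => (qPochInf q (F i))⁻¹ := by
  obtain ⟨δ, hδ, h⟩ := exists_le_norm_qPochInf_of_qRegular hq1 hx
  exact unifBdd_inv_of_le hδ fun i => by simpa [hF] using h (m i)

lemma UnifBdd.congr (hF : UnifBdd F) (h : ∀ i, G i = F i) : UnifBdd G := by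
  rwa [show G = F from funext h]

lemma UnifBdd.comp {κ : Type*} (hF : UnifBdd F) (g : κ → ι) : UnifBdd fun k => F (g k) :=
  let ⟨C, hC⟩ := hF; ⟨C, fun k => hC (g k)⟩

lemma UnifBdd.summable {F : ℕ → ℂ} (hF : UnifBdd F) (hq1 : ‖q‖ < 1) :
    Summable fun k => F k * q ^ k := by
  obtain ⟨C, hC⟩ := hF
  refine Summable.of_norm_bounded (g := fun k => C * ‖q‖ ^ k)
    ((summable_geometric_of_lt_one (norm_nonneg _) hq1).mul_left _) fun k => ?_
  rw [norm_mul, norm_pow]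
  gcongr
  exact hC k

end Bounded

/-! ### The nonterminating summation -/

section Summation

variable {q b β u v z : ℂ}

/-- The bound is uniform both in the number `p.1` of shifts and in the summation index `p.2`, as
dominated convergence for `u, v → 0` requires. -/
lemma unifBdd_wpRatio (hq1 : ‖q‖ < 1) (h : WPRegular q b β u v) :
    UnifBdd fun p : ℕ × ℕ => wpRatio q b β (u * q ^ p.1) (v * q ^ p.1) p.2 := by
  have hp : ∀ (x : ℂ) (m : ℕ × ℕ → ℕ) (y : ℕ × ℕ → ℂ), (∀ p, y p = x * q ^ m p) → UnifBdd y :=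
    fun x m y hy => (unifBdd_mul_pow hq1 x m).congr hy
  have n1 : UnifBdd fun p : ℕ × ℕ => qPochInf q (u * q ^ p.1 * b * q ^ p.2) :=
    (hp (u * b) (fun p => p.1 + p.2) _ fun p => by ring).qPochInf hq1
  have n2 : UnifBdd fun p : ℕ × ℕ => qPochInf q (v * q ^ p.1 * b * q ^ p.2) :=
    (hp (v * b) (fun p => p.1 + p.2) _ fun p => by ring).qPochInf hq1
  have n3 : UnifBdd fun p : ℕ × ℕ => qPochInf q (u * q ^ p.1 / b) :=
    (hp (u / b) (fun p => p.1) _ fun p => by ring).qPochInf hq1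
  have n4 : UnifBdd fun p : ℕ × ℕ => qPochInf q (v * q ^ p.1 / b) :=
    (hp (v / b) (fun p => p.1) _ fun p => by ring).qPochInf hq1
  have n5 : UnifBdd fun p : ℕ × ℕ =>
      1 - b * (u * q ^ p.1 * (v * q ^ p.1) / β) / q * q ^ (2 * p.2) :=
    (unifBdd_const 1).sub (hp (b * (u * v / β) / q) (fun p => 2 * p.1 + 2 * p.2) _ fun p => by ring)
  have n6 : UnifBdd fun p : ℕ × ℕ => qPoch q (v * q ^ p.1 / β) p.2 :=
    (hp (v / β) (fun p => p.1) _ fun p => by ring).qPoch hq1 _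
  have n7 : UnifBdd fun p : ℕ × ℕ => qPoch q (u * q ^ p.1 / β) p.2 :=
    (hp (u / β) (fun p => p.1) _ fun p => by ring).qPoch hq1 _
  have n8 : UnifBdd fun p : ℕ × ℕ => qPoch q (u * q ^ p.1 * (v * q ^ p.1) / q) p.2 :=
    (hp (u * v / q) (fun p => 2 * p.1) _ fun p => by ring).qPoch hq1 _
  have d1 : UnifBdd fun p : ℕ × ℕ =>
      (qPochInf q (b * (u * q ^ p.1 * (v * q ^ p.1) / β) / q * q ^ p.2))⁻¹ :=
    unifBdd_inv_qPochInf hq1 h.reg_bc (fun p => 2 * p.1 + p.2) fun p => by ring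
  have d2 : UnifBdd fun p : ℕ × ℕ => (qPochInf q (u * q ^ p.1 * (v * q ^ p.1) / (b * β)))⁻¹ :=
    unifBdd_inv_qPochInf hq1 h.reg_c_div_b (fun p => 2 * p.1) fun p => by ring
  have d3 : UnifBdd fun p : ℕ × ℕ => (qPoch q q p.2)⁻¹ := unifBdd_inv_qPoch hq1 (qRegular_self hq1) _
  have d4 : UnifBdd fun p : ℕ × ℕ => (qPoch q (b / β * q) p.2)⁻¹ :=
    unifBdd_inv_qPoch hq1 h.reg_b_div_β.mul_q _
  refine UnifBdd.congr (((((n1.mul n2).mul n3).mul n4).mul n5).mul ((n6.mul n7).mul n8) |>.mul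
    ((((d1.mul d2).mul (unifBdd_const (qPochInf q (b * β))⁻¹)).mul
      (unifBdd_const (qPochInf q (β / b))⁻¹)).mul (d3.mul d4))) fun p => ?_
  simp only [wpRatio, div_eq_mul_inv, mul_inv]

/-- The separate base `q'` is needed because shifting both `u` and `v` by `q` shifts `c = uv/β` by
`q ^ 2`. -/
lemma unifBdd_wpTerm (hq1 : ‖q‖ < 1) (q' b c z : ℂ) (hq' : ‖q'‖ < 1) :
    UnifBdd fun p : ℕ × ℕ => wpTerm q b (c * q' ^ p.1) z p.2 := by
  have hc : UnifBdd fun p : ℕ × ℕ => c * q' ^ p.1 := unifBdd_mul_pow hq' _ _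
  have hp := unifBdd_mul_pow (ι := ℕ × ℕ) hq1 1 fun p => p.2
  simp only [one_mul] at hp
  have n1 := ((hc.mul (unifBdd_const z)).mul hp).qPochInf hq1
  have n2 := ((hc.mul (unifBdd_const z⁻¹)).mul hp).qPochInf hq1
  have n3 := (unifBdd_const (ι := ℕ × ℕ) (b * z)).qPoch hq1 fun p => p.2
  have n4 := (unifBdd_const (ι := ℕ × ℕ) (b / z)).qPoch hq1 fun p => p.2
  refine UnifBdd.congr ((n3.mul n4).mul (n1.mul n2)) fun p => ?_
  simp only [wpTerm, div_eq_mul_inv]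

lemma unifBdd_wpRatio_mul_wpTerm (hq1 : ‖q‖ < 1) (h : WPRegular q b β u v) (z : ℂ) :
    UnifBdd fun p : ℕ × ℕ => wpRatio q b β (u * q ^ p.1) (v * q ^ p.1) p.2 *
      wpTerm q b (u * q ^ p.1 * (v * q ^ p.1) / β) z p.2 := by
  have hq2 : ‖q ^ 2‖ < 1 := by rw [norm_pow]; exact pow_lt_one₀ (norm_nonneg _) hq1 two_ne_zero
  refine (unifBdd_wpRatio hq1 h).mul ((unifBdd_wpTerm hq1 (q ^ 2) b (u * v / β) z hq2).congr ?_)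
  intro p
  congr 1
  ring

lemma summable_wpSeries (hq1 : ‖q‖ < 1) (h : WPRegular q b β u v) (z : ℂ) :
    Summable fun k => wpRatio q b β u v k * q ^ k * wpTerm q b (u * v / β) z k := by
  have := ((unifBdd_wpRatio_mul_wpTerm hq1 h z).comp fun k : ℕ => (0, k)).summable hq1
  simp only [pow_zero, mul_one] at this
  exact this.congr fun k => by ring

/-! ### Summed contiguity and cancellation of the boundary terms -/

lemma sum_wpTerm_shift (hq0 : q ≠ 0) (hq1 : ‖q‖ < 1) (hz : z ≠ 0) (h : WPRegular q b β u v)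
    (n : ℕ) :
    ∑ k ∈ Finset.range (n + 1), (1 - v * z) * (1 - v / z) *
        (wpRatio q b β u (v * q) k * q ^ k * wpTerm q b (u * (v * q) / β) z k) =
      ∑ k ∈ Finset.range (n + 1), wpRatio q b β u v k * q ^ k * wpTerm q b (u * v / β) z k +
        shiftUp q b β u v n * wpRatio q b β u (v * q) n * wpTerm q b (u * v / β) z (n + 1) := by
  induction n with
  | zero =>
    have h1 := mul_wpTerm_shift hq0 hq1 hz h 0
    have h2 := wpRatio_shift_zero hq0 hq1 h
    simp only [zero_add, Finset.sum_range_one]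
    rw [h2]
    simp only [pow_zero, one_mul, mul_one] at h1 ⊢
    linear_combination wpRatio q b β u (v * q) 0 * h1
  | succ n ih =>
    rw [Finset.sum_range_succ, ih, Finset.sum_range_succ _ (n + 1)]
    have h1 := mul_wpTerm_shift hq0 hq1 hz h (n + 1)
    have h2 := wpRatio_shift_succ hq0 hq1 h n
    linear_combination wpRatio q b β u (v * q) (n + 1) * h1 -
      wpTerm q b (u * v / β) z (n + 1) * h2

lemma tendsto_mul_pow (hq1 : ‖q‖ < 1) (x : ℂ) : Tendsto (fun n : ℕ => x * q ^ n) atTop (𝓝 0) := by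
  simpa using (tendsto_pow_atTop_nhds_zero_of_norm_lt_one hq1).const_mul x

lemma tendsto_qPochInf_mul_pow (hq1 : ‖q‖ < 1) (x : ℂ) :
    Tendsto (fun n : ℕ => qPochInf q (x * q ^ n)) atTop (𝓝 1) := by
  have := ((continuous_qPochInf hq1).tendsto 0).comp (tendsto_mul_pow hq1 x)
  rwa [qPochInf_zero] at this

/-- The limit of the boundary term of the contiguity relation. -/
noncomputable def shiftBoundary (q b β u v z : ℂ) : ℂ :=
  v / b / (1 - u * v / (b * β)) *
    (qPochInf q (u / b) * qPochInf q (v * q / b) *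
        (qPochInf q (v * q / β) * qPochInf q (u / β) * qPochInf q (u * (v * q) / q)) /
      (qPochInf q (u * (v * q) / (b * β)) * qPochInf q (b * β) * qPochInf q (β / b) *
        (qPochInf q q * qPochInf q (b / β * q)))) *
    (qPochInf q (b * z) * qPochInf q (b / z))

lemma tendsto_wpRatio (hq1 : ‖q‖ < 1) (h : WPRegular q b β u v) :
    Tendsto (wpRatio q b β u v) atTop (𝓝 (qPochInf q (u / b) * qPochInf q (v / b) *
        (qPochInf q (v / β) * qPochInf q (u / β) * qPochInf q (u * v / q)) /
      (qPochInf q (u * v / (b * β)) * qPochInf q (b * β) * qPochInf q (β / b) *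
        (qPochInf q q * qPochInf q (b / β * q))))) := by
  have t : Tendsto (fun n : ℕ => 1 - b * (u * v / β) / q * q ^ (2 * n)) atTop (𝓝 1) := by
    have := ((tendsto_mul_pow hq1 (b * (u * v / β) / q)).comp
      (tendsto_id.const_mul_atTop' (two_pos (α := ℕ)))).const_sub 1
    simpa using this
  have num := ((((tendsto_qPochInf_mul_pow hq1 (u * b)).mul
    (tendsto_qPochInf_mul_pow hq1 (v * b))).mul_const
    (qPochInf q (u / b))).mul_const (qPochInf q (v / b))).mul t |>.mul
    (((tendsto_qPoch hq1 (v / β)).mul (tendsto_qPoch hq1 (u / β))).mul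
      (tendsto_qPoch hq1 (u * v / q)))
  have den := (((tendsto_qPochInf_mul_pow hq1 (b * (u * v / β) / q)).mul_const
    (qPochInf q (u * v / (b * β)))).mul_const (qPochInf q (b * β))).mul_const
    (qPochInf q (β / b)) |>.mul ((tendsto_qPoch hq1 q).mul (tendsto_qPoch hq1 (b / β * q)))
  have := num.div den (by
    simp only [one_mul]
    exact mul_ne_zero (mul_ne_zero (mul_ne_zero (qPochInf_ne_zero hq1 h.reg_c_div_b)
      (qPochInf_ne_zero hq1 h.reg_bβ)) (qPochInf_ne_zero hq1 h.reg_β_div_b))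
      (mul_ne_zero (qPochInf_ne_zero hq1 (qRegular_self hq1))
        (qPochInf_ne_zero hq1 h.reg_b_div_β.mul_q)))
  simp only [one_mul, mul_one] at this
  exact this

lemma tendsto_shift_boundary (hq0 : q ≠ 0) (hq1 : ‖q‖ < 1) (h : WPRegular q b β u v) (z : ℂ) :
    Tendsto (fun n => shiftUp q b β u v n * wpRatio q b β u (v * q) n *
      wpTerm q b (u * v / β) z (n + 1)) atTop (𝓝 (shiftBoundary q b β u v z)) := by
  have t1 : Tendsto (fun n : ℕ => 1 - b * (u * v / β) * q ^ (2 * n)) atTop (𝓝 1) := by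
    have := ((tendsto_mul_pow hq1 (b * (u * v / β))).comp
      (tendsto_id.const_mul_atTop' (two_pos (α := ℕ)))).const_sub 1
    simpa using this
  have t2 : Tendsto (fun n : ℕ => 1 - v * (u * v / β) * q ^ n) atTop (𝓝 1) := by
    simpa using (tendsto_mul_pow hq1 (v * (u * v / β))).const_sub 1
  have t3 : Tendsto (fun n : ℕ => v / b - u * v / (b * β) * q ^ n) atTop (𝓝 (v / b)) := by
    simpa using (tendsto_mul_pow hq1 (u * v / (b * β))).const_sub (v / b)
  have t4 := (t2.mul t3).div (t1.mul_const (1 - u * v / (b * β)))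
    (by simpa using h.reg_c_div_b.one_sub_ne_zero')
  simp only [one_mul] at t4
  have t5 := ((tendsto_qPoch hq1 (b * z)).mul (tendsto_qPoch hq1 (b / z))).mul
    ((tendsto_qPochInf_mul_pow hq1 (u * v / β * z)).mul
      (tendsto_qPochInf_mul_pow hq1 (u * v / β / z)))
  simp only [mul_one] at t5
  exact (t4.mul (tendsto_wpRatio hq1 (h.mul_q hq0))).mul ((tendsto_add_atTop_iff_nat 1).2 t5)

lemma tsum_wpTerm_shift (hq0 : q ≠ 0) (hq1 : ‖q‖ < 1) (hz : z ≠ 0) (h : WPRegular q b β u v) :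
    (1 - v * z) * (1 - v / z) *
        ∑' k, wpRatio q b β u (v * q) k * q ^ k * wpTerm q b (u * (v * q) / β) z k =
      ∑' k, wpRatio q b β u v k * q ^ k * wpTerm q b (u * v / β) z k +
        shiftBoundary q b β u v z := by
  have h1 := (((summable_wpSeries hq1 (h.mul_q hq0) z).mul_left
    ((1 - v * z) * (1 - v / z))).hasSum.tendsto_sum_nat)
  have h2 := (summable_wpSeries hq1 h z).hasSum.tendsto_sum_nat
  rw [tsum_mul_left] at h1
  have h3 := ((tendsto_add_atTop_iff_nat 1).2 h2).add (tendsto_shift_boundary hq0 hq1 h z)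
  simp only [← sum_wpTerm_shift hq0 hq1 hz h] at h3
  exact tendsto_nhds_unique ((tendsto_add_atTop_iff_nat 1).2 h1) h3

/-- Once a linear factor is split off `(β/b)_∞` and `(b/β)_∞`, the two weighted terms have a common
factor symmetric in `b` and `β`. What is left is `v/(b-β) + v/(β-b) = 0`. -/
lemma shiftBoundary_antisymm (hq1 : ‖q‖ < 1) (h : WPRegular q b β u v) (z : ℂ) :
    qPochInf q (β * z) * qPochInf q (β / z) * shiftBoundary q b β u v z +
      qPochInf q (b * z) * qPochInf q (b / z) * shiftBoundary q β b u v z = 0 := by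
  have hb := h.b_ne; have hβ := h.β_ne
  have n1 : 1 - β / b ≠ 0 := h.reg_β_div_b.one_sub_ne_zero'
  have n2 : 1 - b / β ≠ 0 := h.reg_b_div_β.one_sub_ne_zero'
  have hne : b - β ≠ 0 := by
    intro h0; apply n1; rw [sub_eq_zero.1 h0, div_self hβ, sub_self]
  have key : v / b / (1 - β / b) + v / β / (1 - b / β) = 0 := by
    have e1 : v / b / (1 - β / b) = v / (b - β) := by
      rw [div_div, mul_sub, mul_one, mul_div_cancel₀ _ hb]
    have e2 : v / β / (1 - b / β) = -(v / (b - β)) := by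
      rw [div_div, mul_sub, mul_one, mul_div_cancel₀ _ hβ, ← neg_sub b β, div_neg]
    rw [e1, e2]; ring
  simp only [shiftBoundary]
  rw [mul_comm β b, qPochInf_eq_one_sub_mul hq1 (β / b), qPochInf_eq_one_sub_mul hq1 (b / β)]
  set X := qPochInf q (β * z) * qPochInf q (β / z) * (qPochInf q (b * z) * qPochInf q (b / z)) *
    (qPochInf q (u / b) * qPochInf q (v * q / b) *
        (qPochInf q (v * q / β) * qPochInf q (u / β) * qPochInf q (u * (v * q) / q))) /
      (qPochInf q (u * (v * q) / (b * β)) * qPochInf q (b * β) * qPochInf q q *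
        (qPochInf q (b / β * q) * qPochInf q (β / b * q)) * (1 - u * v / (b * β))) with hX
  have := congrArg (X * ·) key
  simp only [mul_zero] at this
  rw [← this, hX]
  simp only [div_eq_mul_inv, mul_inv]
  ring

/-- The sum of the two series. -/
noncomputable def wpTotal (q b β u v z : ℂ) : ℂ := wpSeries q b β u v z + wpSeries q β b u v z

lemma wpTotal_symm (q b β u v z : ℂ) : wpTotal q b β u v z = wpTotal q β b u v z := add_comm _ _

lemma wpTotal_swap (q b β u v z : ℂ) : wpTotal q b β u v z = wpTotal q b β v u z := by
  simp only [wpTotal, wpSeries_swap q _ _ u v]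

lemma wpTotal_shift (hq0 : q ≠ 0) (hq1 : ‖q‖ < 1) (hz : z ≠ 0) (h : WPRegular q b β u v) :
    wpTotal q b β u v z = (1 - v * z) * (1 - v / z) * wpTotal q b β u (v * q) z := by
  have h1 := tsum_wpTerm_shift hq0 hq1 hz h
  have h2 := tsum_wpTerm_shift hq0 hq1 hz h.symm
  have h3 := shiftBoundary_antisymm hq1 h z
  simp only [wpTotal, wpSeries]
  linear_combination -h3 - qPochInf q (β * z) * qPochInf q (β / z) * h1 -
    qPochInf q (b * z) * qPochInf q (b / z) * h2

/-! ### Iteration to `u = v = 0` and evaluation of the constant -/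

lemma wpTotal_shift_pow (hq0 : q ≠ 0) (hq1 : ‖q‖ < 1) (hz : z ≠ 0) (h : WPRegular q b β u v)
    (N : ℕ) :
    wpTotal q b β u v z = qPoch q (u * z) N * qPoch q (u / z) N *
      (qPoch q (v * z) N * qPoch q (v / z) N) * wpTotal q b β (u * q ^ N) (v * q ^ N) z := by
  induction N with
  | zero => simp
  | succ N ih =>
    have hN := h.mul_pow hq0 N
    rw [ih, wpTotal_shift hq0 hq1 hz hN, wpTotal_swap,
      wpTotal_shift hq0 hq1 hz (hN.mul_q hq0).swap, wpTotal_swap]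
    simp only [qPoch_succ, pow_succ, ← mul_assoc]
    ring

/-- `WPRegular` excludes the origin, but the terms extend continuously: the denominator factors
containing `u` or `v` become `(0; q)_∞ = 1`. -/
lemma continuousAt_wpRatio_mul_wpTerm (hq1 : ‖q‖ < 1) (h : WPRegular q b β u v) (z : ℂ) (k : ℕ) :
    ContinuousAt (fun p : ℂ × ℂ => wpRatio q b β p.1 p.2 k * q ^ k *
      wpTerm q b (p.1 * p.2 / β) z k) (0, 0) := by
  have hc := continuous_qPochInf hq1
  refine ContinuousAt.mul (ContinuousAt.mul ?_ continuousAt_const) ?_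
  · unfold wpRatio
    refine ContinuousAt.div (Continuous.continuousAt (by fun_prop))
      (Continuous.continuousAt (by fun_prop)) ?_
    simp only [mul_zero, zero_div, zero_mul, qPochInf_zero, one_mul]
    exact mul_ne_zero (mul_ne_zero (qPochInf_ne_zero hq1 h.reg_bβ)
      (qPochInf_ne_zero hq1 h.reg_β_div_b))
      (mul_ne_zero (qPoch_ne_zero (qRegular_self hq1) _) (qPoch_ne_zero h.reg_b_div_β.mul_q _))
  · unfold wpTerm
    exact Continuous.continuousAt (by fun_prop)

lemma tendsto_wpSeries (hq1 : ‖q‖ < 1) (h : WPRegular q b β u v) (z : ℂ) :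
    Tendsto (fun N : ℕ => wpSeries q b β (u * q ^ N) (v * q ^ N) z) atTop
      (𝓝 (wpSeries q b β 0 0 z)) := by
  obtain ⟨C, hC⟩ := unifBdd_wpRatio_mul_wpTerm hq1 h z
  refine Tendsto.const_mul _ (tendsto_tsum_of_dominated_convergence
    (bound := fun k => C * ‖q‖ ^ k)
    ((summable_geometric_of_lt_one (norm_nonneg _) hq1).mul_left _) (fun k => ?_)
    (Eventually.of_forall fun N k => ?_))
  · have t := (continuousAt_wpRatio_mul_wpTerm hq1 h z k).tendsto.comp
      ((tendsto_mul_pow hq1 u).prodMk_nhds (tendsto_mul_pow hq1 v))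
    simp only [Function.comp_def] at t
    exact t
  · rw [mul_right_comm, norm_mul, norm_pow]
    gcongr
    exact hC (N, k)

lemma wpTotal_eq_mul_wpTotal_zero (hq0 : q ≠ 0) (hq1 : ‖q‖ < 1) (hz : z ≠ 0)
    (h : WPRegular q b β u v) :
    wpTotal q b β u v z = qPochInf q (u * z) * qPochInf q (u / z) *
      (qPochInf q (v * z) * qPochInf q (v / z)) * wpTotal q b β 0 0 z := by
  have h1 := (((tendsto_qPoch hq1 (u * z)).mul (tendsto_qPoch hq1 (u / z))).mul
    ((tendsto_qPoch hq1 (v * z)).mul (tendsto_qPoch hq1 (v / z)))).mul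
    ((tendsto_wpSeries hq1 h z).add (tendsto_wpSeries hq1 h.symm z))
  refine tendsto_nhds_unique ?_ h1
  refine tendsto_const_nhds.congr fun N => ?_
  exact wpTotal_shift_pow hq0 hq1 hz h N

/-- With `u = β`, every term of the second series contains `(1; q)_∞ = 0`, while `(u/β; q)_k = (1;
q)_k` kills all terms `k ≥ 1` of the first. -/
lemma wpTotal_self (hq0 : q ≠ 0) (hq1 : ‖q‖ < 1) (h : WPRegular q b β β v) :
    wpTotal q b β β v z = qPochInf q (β * z) * qPochInf q (β / z) *
      (qPochInf q (v * z) * qPochInf q (v / z)) := by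
  have hb := h.b_ne; have hβ := h.β_ne
  have h2 : wpSeries q β b β v z = 0 := by
    simp [wpSeries, wpRatio, div_self hβ, qPochInf_one hq1]
  have e : β * v / β = v := by field_simp
  have hr0 : wpRatio q b β β v 0 = 1 := by
    have e2 : β * v / (b * β) = v / b := by field_simp
    have n1 := h.reg_bc
    have n2 := qPochInf_ne_zero hq1 h.reg_c_div_b
    have n3 := qPochInf_ne_zero hq1 h.reg_bβ
    have n4 := qPochInf_ne_zero hq1 h.reg_β_div_b
    have e3 : qPochInf q (b * v / q) = (1 - b * v / q) * qPochInf q (v * b) := by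
      rw [qPochInf_eq_one_sub_mul hq1, div_mul_cancel₀ _ hq0, mul_comm b v]
    rw [e] at n1
    rw [e2] at n2
    have n5 := qPochInf_ne_zero hq1 n1
    simp only [wpRatio, pow_zero, mul_one, qPoch_zero, mul_zero, e, e2]
    rw [div_eq_one_iff_eq (mul_ne_zero (mul_ne_zero (mul_ne_zero n5 n2) n3) n4), e3, mul_comm β b]
    ring
  have h1 : wpSeries q b β β v z = qPochInf q (β * z) * qPochInf q (β / z) *
      (qPochInf q (v * z) * qPochInf q (v / z)) := by
    rw [wpSeries, tsum_eq_single 0]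
    · simp [hr0, wpTerm, e]
    · intro k hk
      obtain ⟨m, rfl⟩ := Nat.exists_eq_succ_of_ne_zero hk
      simp [wpRatio, div_self hβ, qPoch_one_left]
  rw [wpTotal, h1, h2, add_zero]

/-- The constant does not depend on `u` and `v`, so both may be chosen: `u = β` and `v = q ^ n` with
`n` large enough that all regularity conditions hold and `(vz, v/z; q)_∞` does not vanish. -/
lemma wpTotal_zero_of_ne (hq0 : q ≠ 0) (hq1 : ‖q‖ < 1) (hz : z ≠ 0)
    (h : WPRegular q b β u v) (hne : qPochInf q (β * z) * qPochInf q (β / z) ≠ 0) :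
    wpTotal q b β 0 0 z = 1 := by
  have small : ∀ x : ℂ, ∀ᶠ n : ℕ in atTop, QRegular q (x * q ^ n) := fun x => by
    have := (tendsto_mul_pow hq1 x).norm.eventually_lt_const (u := 1) (by simp)
    exact this.mono fun n hn => .of_norm_lt_one hq1 hn
  obtain ⟨n, h1, h2, h3, h4, h5⟩ := ((small z).and <| (small (1 / z)).and <| (small (1 / b)).and <|
    (small (b / q)).and (small (β * (β / b) / q))).exists
  have hb := h.b_ne; have hβ := h.β_ne
  have hv : WPRegular q b β β (q ^ n) :=
    { b_ne := hb, β_ne := hβ, u_ne := hβ, v_ne := pow_ne_zero _ hq0, reg_bβ := h.reg_bβ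
      reg_b_div_β := h.reg_b_div_β, reg_β_div_b := h.reg_β_div_b
      reg_c_div_b := by convert h3 using 1; field_simp
      reg_bc := by convert h4 using 1; field_simp
      reg_βγ := by convert h5 using 1; ring }
  have e := wpTotal_eq_mul_wpTotal_zero hq0 hq1 hz hv
  rw [wpTotal_self hq0 hq1 hv] at e
  have hne2 : qPochInf q (q ^ n * z) * qPochInf q (q ^ n / z) ≠ 0 := by
    refine mul_ne_zero (qPochInf_ne_zero hq1 ?_) (qPochInf_ne_zero hq1 ?_)
    · rwa [mul_comm]
    · convert h2 using 1; ring
  exact (mul_left_cancel₀ (mul_ne_zero hne hne2) (by rw [mul_one]; exact e)).symm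

/-- If `(βz, β/z; q)_∞ = 0`, the roles of `b` and `β` are exchanged. Both products cannot vanish,
since then `bβ`, `b/β` or `β/b` would be a nonpositive power of `q`. -/
lemma wpTotal_zero (hq0 : q ≠ 0) (hq1 : ‖q‖ < 1) (hz : z ≠ 0) (h : WPRegular q b β u v) :
    wpTotal q b β 0 0 z = 1 := by
  by_cases hβ : qPochInf q (β * z) * qPochInf q (β / z) = 0
  · rw [wpTotal_symm]
    refine wpTotal_zero_of_ne hq0 hq1 hz h.symm fun hb => ?_
    have irr : ∀ x : ℂ, qPochInf q x = 0 → ∃ m : ℕ, x * q ^ m = 1 := fun x hx => by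
      by_contra hcon
      exact qPochInf_ne_zero hq1 (fun m hm => hcon ⟨m, hm⟩) hx
    have hb0 := h.b_ne; have hβ0 := h.β_ne
    have cross : ∀ x y : ℂ, QRegular q (x / y) → QRegular q (y / x) → x ≠ 0 → y ≠ 0 →
        ∀ m n : ℕ, x * q ^ m = 1 → y * q ^ n ≠ 1 := by
      intro x y hxy hyx hx hy m n h1 h2
      have hqm := pow_ne_zero m hq0
      have hqn := pow_ne_zero n hq0
      rcases le_total m n with hmn | hmn
      · apply hyx (n - m)
        rw [← mul_right_inj' hqm, mul_left_comm, ← pow_add, Nat.add_sub_cancel' hmn]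
        field_simp
        linear_combination h2 - h1
      · apply hxy (m - n)
        rw [← mul_right_inj' hqn, mul_left_comm, ← pow_add, Nat.add_sub_cancel' hmn]
        field_simp
        linear_combination h1 - h2
    rcases mul_eq_zero.1 hβ with h1 | h1 <;> rcases mul_eq_zero.1 hb with h2 | h2 <;>
      obtain ⟨m, hm⟩ := irr _ h1 <;> obtain ⟨n, hn⟩ := irr _ h2
    · refine cross (β * z) (b * z) ?_ ?_ (by positivity) (by positivity) m n hm hn
      · convert h.reg_β_div_b using 1; field_simp
      · convert h.reg_b_div_β using 1; field_simp
    · apply h.reg_bβ (m + n)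
      calc b * β * q ^ (m + n) = (β * z * q ^ m) * (b / z * q ^ n) := by rw [pow_add]; field_simp
        _ = 1 := by rw [hm, hn, one_mul]
    · apply h.reg_bβ (m + n)
      calc b * β * q ^ (m + n) = (β / z * q ^ m) * (b * z * q ^ n) := by rw [pow_add]; field_simp
        _ = 1 := by rw [hm, hn, one_mul]
    · refine cross (β / z) (b / z) ?_ ?_ (by positivity) (by positivity) m n hm hn
      · convert h.reg_β_div_b using 1; field_simp
      · convert h.reg_b_div_β using 1; field_simp
  · exact wpTotal_zero_of_ne hq0 hq1 hz h hβ

/-- The nonterminating well-poised summation, cleared of denominators in `z`. -/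
theorem wpSeries_add_wpSeries (hq0 : q ≠ 0) (hq1 : ‖q‖ < 1) (hz : z ≠ 0)
    (h : WPRegular q b β u v) :
    wpSeries q b β u v z + wpSeries q β b u v z =
      qPochInf q (u * z) * qPochInf q (u / z) * (qPochInf q (v * z) * qPochInf q (v / z)) := by
  have := wpTotal_eq_mul_wpTotal_zero hq0 hq1 hz h
  rwa [wpTotal_zero hq0 hq1 hz h, mul_one] at this

end Summation

/-! ### Taylor coefficients of the kernel -/

section Taylor

variable {q s b c d e z : ℂ}

/-- The left side is antisymmetric under `z ↦ 1/z`, and `pr = tw` makes it a multiple of `z - 1/z`.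
This cancels the denominator of the divided difference. -/
lemma antisymm_identity {p r t w : ℂ} (hz : z ≠ 0) (h : p * r = t * w) :
    (1 - p / z) * (1 - r / z) * ((1 - t * z) * (1 - w * z)) -
      (1 - p * z) * (1 - r * z) * ((1 - t / z) * (1 - w / z)) =
    (p + r - t - w) * (1 - t * w) * (z - z⁻¹) := by
  field_simp
  linear_combination (1 - z ^ 4 + (z ^ 3 - z) * (t + w)) * h

/-- The factor by which the well-poised operator multiplies the kernel. -/
noncomputable def kernFactor (q c d e : ℂ) : ℂ :=
  2 * c / (d * e * (1 - q)) * ((1 - d) * (1 - e) * (1 - c ^ 2 / (d * e * q)))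

/-- The well-poised operator maps the kernel to a kernel with shifted parameters. -/
lemma wpD_kernH (hs0 : s ≠ 0) (hs1 : ‖s ^ 2‖ < 1) (hd : d ≠ 0) (he : e ≠ 0) (hz : z ≠ 0)
    (hz2 : z - z⁻¹ ≠ 0) (h1 : 1 - c / s / z ≠ 0) (h2 : 1 - c / s * z ≠ 0)
    (h3 : 1 - c / (d * e * s) / z ≠ 0) (h4 : 1 - c / (d * e * s) * z ≠ 0)
    (h5 : 1 - c * s * z ≠ 0) (h6 : 1 - c * s / z ≠ 0) {F : ℂ → ℂ} {κ : ℂ}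
    (hF : F (s * z) = κ * kernH (s ^ 2) c d e (s * z))
    (hF' : F (s⁻¹ * z) = κ * kernH (s ^ 2) c d e (s⁻¹ * z)) :
    wpD s c F z = κ * kernFactor (s ^ 2) c d e *
      kernH (s ^ 2) (c * s ^ 3) (d * s ^ 2) (e * s ^ 2) z := by
  set I := qPochInf (s ^ 2) with hI
  have step : ∀ x y w : ℂ, w = x → y = x * s ^ 2 → I w = (1 - x) * I y := by
    rintro x y w rfl rfl
    exact qPochInf_eq_one_sub_mul hs1 _
  have hsq : 1 - s ^ 2 ≠ 0 := (QRegular.of_norm_lt_one hs1 hs1).one_sub_ne_zero'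
  have hss : s - s⁻¹ ≠ 0 := by
    intro h0
    apply hsq
    have : s * (s - s⁻¹) = 0 := by rw [h0, mul_zero]
    rw [mul_sub, mul_inv_cancel₀ hs0] at this
    linear_combination -this
  -- The kernels at `sz` and `z/s` and the shifted kernel at `z` differ from `G` only by finitely
  -- many linear factors.
  set G := I (c * s * z / d) * I (c * s / (d * z)) * I (c * s * z / e) * I (c * s / (e * z)) /
    (I (c * s ^ 3 * z) * I (c * s ^ 3 / z) * I (c * s * z / (d * e)) * I (c * s / (d * e * z)))
    with hG
  have a1 : kernH (s ^ 2) c d e (s * z) = G * ((1 - c / (d * s) / z) * (1 - c / (e * s) / z) /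
      ((1 - c * s * z) * (1 - c * s / z) * ((1 - c / s / z) * (1 - c / (d * e * s) / z)))) := by
    simp only [kernH, ← hI]
    rw [step (c / (d * s) / z) (c * s / (d * z)) (c / (d * (s * z))) (by field_simp) (by field_simp),
      step (c / (e * s) / z) (c * s / (e * z)) (c / (e * (s * z))) (by field_simp) (by field_simp),
      step (c / (d * e * s) / z) (c * s / (d * e * z)) (c / (d * e * (s * z))) (by field_simp)
        (by field_simp),
      step (c / s / z) (c * s / z) (c / (s * z)) (by field_simp) (by field_simp),
      step (c * s / z) (c * s ^ 3 / z) (c * s / z) rfl (by ring),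
      step (c * s * z) (c * s ^ 3 * z) (c * (s * z)) (by ring) (by ring), hG,
      show c * (s * z) / d = c * s * z / d by ring, show c * (s * z) / e = c * s * z / e by ring,
      show c * (s * z) / (d * e) = c * s * z / (d * e) by ring, div_mul_div_comm]
    congr 1 <;> ring
  have a2 : kernH (s ^ 2) c d e (s⁻¹ * z) = G * ((1 - c / (d * s) * z) * (1 - c / (e * s) * z) /
      ((1 - c * s * z) * (1 - c * s / z) * ((1 - c / s * z) * (1 - c / (d * e * s) * z)))) := by
    simp only [kernH, ← hI]
    rw [step (c / (d * s) * z) (c * s * z / d) (c * (s⁻¹ * z) / d) (by field_simp) (by field_simp),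
      step (c / (e * s) * z) (c * s * z / e) (c * (s⁻¹ * z) / e) (by field_simp) (by field_simp),
      step (c / (d * e * s) * z) (c * s * z / (d * e)) (c * (s⁻¹ * z) / (d * e)) (by field_simp)
        (by field_simp),
      step (c / s * z) (c * s * z) (c * (s⁻¹ * z)) (by field_simp) (by field_simp),
      step (c * s * z) (c * s ^ 3 * z) (c * s * z) rfl (by ring),
      step (c * s / z) (c * s ^ 3 / z) (c / (s⁻¹ * z)) (by field_simp) (by ring), hG,
      show c / (d * (s⁻¹ * z)) = c * s / (d * z) by field_simp,
      show c / (e * (s⁻¹ * z)) = c * s / (e * z) by field_simp,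
      show c / (d * e * (s⁻¹ * z)) = c * s / (d * e * z) by field_simp, div_mul_div_comm]
    congr 1 <;> ring
  have a3 : kernH (s ^ 2) (c * s ^ 3) (d * s ^ 2) (e * s ^ 2) z =
      G * (1 / ((1 - c / (d * e * s) * z) * (1 - c / (d * e * s) / z))) := by
    simp only [kernH, ← hI]
    rw [step (c / (d * e * s) * z) (c * s * z / (d * e)) (c * s ^ 3 * z / (d * s ^ 2 * (e * s ^ 2)))
        (by field_simp) (by field_simp),
      step (c / (d * e * s) / z) (c * s / (d * e * z)) (c * s ^ 3 / (d * s ^ 2 * (e * s ^ 2) * z))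
        (by field_simp) (by field_simp), hG,
      show c * s ^ 3 * z / (d * s ^ 2) = c * s * z / d by field_simp,
      show c * s ^ 3 * z / (e * s ^ 2) = c * s * z / e by field_simp,
      show c * s ^ 3 / (d * s ^ 2 * z) = c * s / (d * z) by field_simp,
      show c * s ^ 3 / (e * s ^ 2 * z) = c * s / (e * z) by field_simp, div_mul_div_comm]
    congr 1 <;> ring
  have key := antisymm_identity (p := c / (d * s)) (r := c / (e * s)) (t := c / s)
    (w := c / (d * e * s)) hz (by field_simp)
  have hc : (c / (d * s) + c / (e * s) - c / s - c / (d * e * s)) *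
      (1 - c / s * (c / (d * e * s))) = kernFactor (s ^ 2) c d e * ((s - s⁻¹) / 2) := by
    simp only [kernFactor]
    field_simp
    ring
  rw [hc] at key
  rw [wpD, askeyWilsonD, hF, hF', a1, a2, a3,
    show c * z * s⁻¹ = c / s * z by ring, show c * z * s = c * s * z by ring,
    show c * s⁻¹ / z = c / s / z by ring]
  generalize 1 - c / (d * s) / z = p1 at *
  generalize 1 - c / (e * s) / z = p2 at *
  generalize 1 - c / (d * s) * z = p3 at *
  generalize 1 - c / (e * s) * z = p4 at *
  generalize 1 - c / s / z = D1 at *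
  generalize 1 - c / s * z = D2 at *
  generalize 1 - c / (d * e * s) / z = D3 at *
  generalize 1 - c / (d * e * s) * z = D4 at *
  generalize 1 - c * s * z = D5 at *
  generalize 1 - c * s / z = D6 at *
  generalize z - z⁻¹ = Z at *
  generalize s - s⁻¹ = S at *
  generalize kernFactor (s ^ 2) c d e = f at *
  clear a1 a2 a3
  clear_value G
  clear hG hc hF hF'
  field_simp
  linear_combination 2 * κ * G * key

lemma QRegular.div_q (hq0 : q ≠ 0) {x : ℂ} (hx : QRegular q x) (hne : x ≠ q) :
    QRegular q (x / q) := by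
  intro m hm
  cases m with
  | zero =>
    rw [pow_zero, mul_one, div_eq_one_iff_eq hq0] at hm
    exact hne hm
  | succ m =>
    apply hx m
    rw [← hm, pow_succ']
    field_simp

lemma qPoch_reflect (hq0 : q ≠ 0) {x : ℂ} (hx : x ≠ 0) (k : ℕ) :
    qPoch q (x * q) k = (-x) ^ k * q ^ (k + k.choose 2) * qPoch q (x⁻¹ * (q ^ k)⁻¹) k := by
  induction k with
  | zero => simp
  | succ k ih =>
    have e1 : x⁻¹ * (q ^ (k + 1))⁻¹ * q = x⁻¹ * (q ^ k)⁻¹ := by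
      rw [pow_succ]; field_simp
    have e2 : k + 1 + (k + 1).choose 2 = (k + k.choose 2) + (k + 1) := by
      simp [Nat.choose_succ_succ']; ring
    rw [qPoch_succ, ih, qPoch_succ', e1, e2, pow_add _ (k + k.choose 2), pow_succ (-x)]
    have : 1 - x * q * q ^ k = -x * q ^ (k + 1) * (1 - x⁻¹ * (q ^ (k + 1))⁻¹) := by
      have := pow_ne_zero (k + 1) hq0
      rw [mul_assoc x, ← pow_succ']
      field_simp
      ring
    rw [this]; ring

/-- The operator at `z` only uses values at `sz` and `z/s`, so the induction runs along the grid `b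
q^{k/2+m}`, for all `m` at once; there genericity keeps every denominator away from zero. The Taylor
coefficient needs only `m = 0`. -/
lemma wpDIter_kernH (hs0 : s ≠ 0) (hs1 : ‖s ^ 2‖ < 1) (h : Generic (s ^ 2) b c d e) (k m : ℕ) :
    wpDIter s c k (kernH (s ^ 2) c d e) (b * s ^ k * (s ^ 2) ^ m) =
      (2 * c / (d * e * (1 - s ^ 2))) ^ k * (s ^ k.choose 2)⁻¹ *
        (qPoch (s ^ 2) d k * qPoch (s ^ 2) e k * qPoch (s ^ 2) (c ^ 2 / (d * e * s ^ 2)) k) *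
        kernH (s ^ 2) (c * s ^ (3 * k)) (d * (s ^ 2) ^ k) (e * (s ^ 2) ^ k)
          (b * s ^ k * (s ^ 2) ^ m) := by
  have hb := h.b_ne; have hc := h.c_ne; have hd := h.d_ne; have he := h.e_ne
  induction k generalizing m with
  | zero => simp [wpDIter]
  | succ k ih =>
    have hsp : ∀ n : ℕ, s ^ n ≠ 0 := fun n => pow_ne_zero n hs0
    -- Grid points avoid the zeros of `(c/z; q)_∞`: neither `b/c` nor `c/b` is a nonpositive power
    -- of `q`.
    have cb : ∀ i j : ℕ, c * (s ^ 2) ^ i ≠ b * (s ^ 2) ^ j := by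
      intro i j hij
      have hi := pow_ne_zero i (pow_ne_zero 2 hs0)
      have hj := pow_ne_zero j (pow_ne_zero 2 hs0)
      rcases le_total i j with hle | hle
      · apply h.reg_b_div_c (j - i)
        rw [← mul_right_inj' hi, mul_left_comm, ← pow_add, Nat.add_sub_cancel' hle]
        field_simp
        linear_combination -hij
      · apply h.reg_c_div_b (i - j)
        rw [← mul_right_inj' hj, mul_left_comm, ← pow_add, Nat.add_sub_cancel' hle]
        field_simp
        linear_combination hij
    set z := b * s ^ (k + 1) * (s ^ 2) ^ m with hz
    have hz0 : z ≠ 0 := by positivity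
    have hz2 : z - z⁻¹ ≠ 0 := by
      intro h0
      -- The exponent comes from `z ^ 2 = b ^ 2 * q ^ (k + 1 + 2 * m)`.
      apply h.grid_b (k + 1 + 2 * m) (by omega)
      have : z * (z - z⁻¹) = 0 := by rw [h0, mul_zero]
      rw [mul_sub, mul_inv_cancel₀ hz0] at this
      rw [hz] at this
      linear_combination this
    have e1 : s * z = b * s ^ k * (s ^ 2) ^ (m + 1) := by rw [hz]; ring
    have e2 : s⁻¹ * z = b * s ^ k * (s ^ 2) ^ m := by rw [hz, pow_succ]; field_simp
    have hF := ih (m + 1)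
    have hF' := ih m
    rw [← e1] at hF
    rw [← e2] at hF'
    have hstep := wpD_kernH (c := c * s ^ (3 * k)) (d := d * (s ^ 2) ^ k) (e := e * (s ^ 2) ^ k)
      (z := z) hs0 hs1 (by positivity) (by positivity) hz0 hz2
      (by
        rw [sub_ne_zero]; intro h0
        apply cb k (m + 1)
        rw [hz] at h0
        field_simp at h0
        have := mul_left_cancel₀ (hsp k) (show s ^ k * (c * (s ^ 2) ^ k) =
          s ^ k * (b * (s ^ 2) ^ (m + 1)) by
          linear_combination -h0)
        exact this)
      (by
        convert h.reg_bc.one_sub_ne_zero (2 * k + m) using 2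
        rw [hz]; field_simp; ring)
      (by
        rw [sub_ne_zero]; intro h0
        apply h.reg_bde_div_c (k + 1 + m)
        rw [hz] at h0
        field_simp at h0 ⊢
        have := mul_left_cancel₀ (hsp (3 * k))
          (show s ^ (3 * k) * (b * d * e * (s ^ 2) ^ (k + 1 + m)) =
          s ^ (3 * k) * c by linear_combination h0)
        linear_combination this)
      (by
        convert h.reg_bc_div_de.one_sub_ne_zero m using 2
        rw [hz]; field_simp; ring)
      (by
        convert h.reg_bc.one_sub_ne_zero (2 * k + m + 1) using 2
        rw [hz]; field_simp; ring)
      (by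
        rw [sub_ne_zero]; intro h0
        apply cb k m
        rw [hz] at h0
        field_simp at h0
        have := mul_left_cancel₀ (hsp (k + 1)) (show s ^ (k + 1) * (c * (s ^ 2) ^ k) =
          s ^ (k + 1) * (b * (s ^ 2) ^ m) by linear_combination -h0)
        exact this)
      hF hF'
    rw [wpDIter, hstep]
    have a1 : c * s ^ (3 * k) * s ^ 3 = c * s ^ (3 * (k + 1)) := by ring
    have a2 : d * (s ^ 2) ^ k * s ^ 2 = d * (s ^ 2) ^ (k + 1) := by ring
    have a3 : e * (s ^ 2) ^ k * s ^ 2 = e * (s ^ 2) ^ (k + 1) := by ring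
    rw [a1, a2, a3]
    congr 1
    have b1 : kernFactor (s ^ 2) (c * s ^ (3 * k)) (d * (s ^ 2) ^ k) (e * (s ^ 2) ^ k) =
        2 * c / (d * e * (1 - s ^ 2)) * (s ^ k)⁻¹ * ((1 - d * (s ^ 2) ^ k) * (1 - e * (s ^ 2) ^ k) *
          (1 - c ^ 2 / (d * e * s ^ 2) * (s ^ 2) ^ k)) := by
      have c1 : (c * s ^ (3 * k)) ^ 2 / (d * (s ^ 2) ^ k * (e * (s ^ 2) ^ k) * s ^ 2) =
          c ^ 2 / (d * e * s ^ 2) * (s ^ 2) ^ k := by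
        field_simp; ring
      have c2 : 2 * (c * s ^ (3 * k)) / (d * (s ^ 2) ^ k * (e * (s ^ 2) ^ k) * (1 - s ^ 2)) =
          2 * c / (d * e * (1 - s ^ 2)) * (s ^ k)⁻¹ := by
        have hsq : 1 - s ^ 2 ≠ 0 := (QRegular.of_norm_lt_one hs1 hs1).one_sub_ne_zero'
        generalize 1 - s ^ 2 = S at *
        field_simp; ring
      rw [kernFactor, c1, c2]
    have b2 : (k + 1).choose 2 = k + k.choose 2 := by simp [Nat.choose_succ_succ']
    rw [b1, b2, pow_add s, mul_inv, pow_succ (2 * c / (d * e * (1 - s ^ 2)))]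
    simp only [qPoch_succ]
    ring

lemma kernH_shift (hs0 : s ≠ 0) (hs1 : ‖s ^ 2‖ < 1) (h : Generic (s ^ 2) b c d e) (k : ℕ) :
    kernH (s ^ 2) (c * s ^ (3 * k)) (d * (s ^ 2) ^ k) (e * (s ^ 2) ^ k) (b * s ^ k) =
      kernH (s ^ 2) c d e b * (qPoch (s ^ 2) (b * c) (2 * k) * qPoch (s ^ 2) (c / b) k /
        (qPoch (s ^ 2) (b * c / d) k * qPoch (s ^ 2) (b * c / e) k *
          qPoch (s ^ 2) (c / (b * d * e) * ((s ^ 2) ^ k)⁻¹) k)) := by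
  have hb := h.b_ne; have hc := h.c_ne; have hd := h.d_ne; have he := h.e_ne
  set I := qPochInf (s ^ 2) with hI
  set P := qPoch (s ^ 2) with hP
  have step : ∀ (n : ℕ) (x w y : ℂ), w = x → y = x * (s ^ 2) ^ n → I w = P x n * I y := by
    rintro n x w y rfl rfl
    exact qPochInf_eq_mul hs1 _ n
  have n1 := qPoch_ne_zero h.reg_bc (2 * k)
  have n2 := qPoch_ne_zero h.reg_c_div_b k
  have n3 := qPoch_ne_zero h.reg_bc_div_d k
  have n4 := qPoch_ne_zero h.reg_bc_div_e k
  simp only [kernH, ← hI]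
  rw [step k (b * c / d) (c * b / d) (c * s ^ (3 * k) * (b * s ^ k) / (d * (s ^ 2) ^ k))
      (by ring) (by field_simp; ring),
    step k (b * c / e) (c * b / e) (c * s ^ (3 * k) * (b * s ^ k) / (e * (s ^ 2) ^ k))
      (by ring) (by field_simp; ring),
    step (2 * k) (b * c) (c * b) (c * s ^ (3 * k) * (b * s ^ k)) (by ring) (by ring),
    step k (c / b) (c / b) (c * s ^ (3 * k) / (b * s ^ k)) rfl (by field_simp; ring),
    step k (c / (b * d * e) * ((s ^ 2) ^ k)⁻¹)
      (c * s ^ (3 * k) / (d * (s ^ 2) ^ k * (e * (s ^ 2) ^ k) * (b * s ^ k))) (c / (d * e * b))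
      (by field_simp; ring) (by field_simp),
    show c * s ^ (3 * k) / (d * (s ^ 2) ^ k * (b * s ^ k)) = c / (d * b) by field_simp; ring,
    show c * s ^ (3 * k) / (e * (s ^ 2) ^ k * (b * s ^ k)) = c / (e * b) by field_simp; ring,
    show c * s ^ (3 * k) * (b * s ^ k) / (d * (s ^ 2) ^ k * (e * (s ^ 2) ^ k)) = c * b / (d * e) by
      field_simp; ring]
  have hr : ∀ a₁ a₂ a₃ a₄ i₁ i₂ i₃ i₄ i₅ i₆ i₇ i₈ y : ℂ, a₁ ≠ 0 → a₂ ≠ 0 → a₃ ≠ 0 → a₄ ≠ 0 →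
      i₁ * i₂ * i₃ * i₄ / (i₅ * i₆ * i₇ * (y * i₈)) =
        a₃ * i₁ * i₂ * (a₄ * i₃) * i₄ / (a₁ * i₅ * (a₂ * i₆) * i₇ * i₈) *
          (a₁ * a₂ / (a₃ * a₄ * y)) := by
    intro a₁ a₂ a₃ a₄ i₁ i₂ i₃ i₄ i₅ i₆ i₇ i₈ y h1 h2 h3 h4
    rw [div_mul_div_comm, ← mul_div_mul_left _ _ (mul_ne_zero (mul_ne_zero h1 h2)
      (mul_ne_zero h3 h4))]
    congr 1 <;> ring
  exact hr _ _ _ _ _ _ _ _ _ _ _ _ _ n1 n2 n3 n4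

/-- The Taylor coefficients of the kernel are the coefficients of the very-well-poised series. -/
theorem taylorCoeff_kernH (hs0 : s ≠ 0) (hs1 : ‖s ^ 2‖ < 1) (h : Generic (s ^ 2) b c d e) (k : ℕ) :
    taylorCoeff (s ^ 2) s b c (kernH (s ^ 2) c d e) k =
      kernH (s ^ 2) c d e b * coeffF (s ^ 2) b c d e k := by
  have hb := h.b_ne; have hc := h.c_ne; have hd := h.d_ne; have he := h.e_ne
  have hD := wpDIter_kernH hs0 hs1 h k 0
  rw [pow_zero, mul_one] at hD
  rw [taylorCoeff, hD, kernH_shift hs0 hs1 h]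
  have hq0 : s ^ 2 ≠ 0 := pow_ne_zero 2 hs0
  have hx : b * d * e / c ≠ 0 := by positivity
  -- Reversing the product yields `(bdeq/c; q)_k`, the factor `q ^ k` of `f_k`, and the square that
  -- cancels both factors `(s ^ k.choose 2)⁻¹`.
  have r1 : qPoch (s ^ 2) (b * d * e * s ^ 2 / c) k = (-(b * d * e / c)) ^ k *
      ((s ^ 2) ^ k * (s ^ k.choose 2) ^ 2) *
        qPoch (s ^ 2) (c / (b * d * e) * ((s ^ 2) ^ k)⁻¹) k := by
    have := qPoch_reflect hq0 hx k
    rw [show b * d * e / c * s ^ 2 = b * d * e * s ^ 2 / c by ring, inv_div, pow_add,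
      ← pow_mul s 2 (k.choose 2), mul_comm 2, pow_mul s _ 2] at this
    exact this
  -- Splitting `(bc/q; q)_{2k+1}` produces the very-well-poised factor and cancels `(bcq^{k-1};
  -- q)_k` from the Taylor normalization.
  have r2 : qPoch (s ^ 2) (b * c) (2 * k) * (1 - b * c / s ^ 2) =
      qPoch (s ^ 2) (b * c / s ^ 2) k * qPoch (s ^ 2) (b * c * (s ^ 2) ^ k / s ^ 2) k *
        (1 - b * c * (s ^ 2) ^ (2 * k) / s ^ 2) := by
    have h1 : qPoch (s ^ 2) (b * c / s ^ 2) (2 * k + 1) =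
        (1 - b * c / s ^ 2) * qPoch (s ^ 2) (b * c) (2 * k) := by
      rw [qPoch_succ', div_mul_cancel₀ _ hq0]
    rw [mul_comm, ← h1, qPoch_succ, two_mul, qPoch_add,
      show b * c / s ^ 2 * (s ^ 2) ^ k = b * c * (s ^ 2) ^ k / s ^ 2 by ring]
    ring
  have hbcreg : QRegular (s ^ 2) (b * c / s ^ 2) := h.reg_bc.div_q hq0 h.bc_ne_q
  have hbcq : 1 - b * c / s ^ 2 ≠ 0 := hbcreg.one_sub_ne_zero'
  have n1 : qPoch (s ^ 2) (b * c * (s ^ 2) ^ k / s ^ 2) k ≠ 0 := by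
    rw [show b * c * (s ^ 2) ^ k / s ^ 2 = b * c / s ^ 2 * (s ^ 2) ^ k by ring]
    exact qPoch_ne_zero (hbcreg.shift k) k
  have n2 := qPoch_ne_zero h.reg_c_div_b k
  have n3 := qPoch_ne_zero h.reg_bc_div_d k
  have n4 := qPoch_ne_zero h.reg_bc_div_e k
  have n5 := qPoch_ne_zero (qRegular_self hs1) k
  have n6 : qPoch (s ^ 2) (b * d * e * s ^ 2 / c) k ≠ 0 := by
    convert qPoch_ne_zero h.reg_bde_div_c.mul_q k using 2; ring
  have n7 : qPoch (s ^ 2) (c / (b * d * e) * ((s ^ 2) ^ k)⁻¹) k ≠ 0 := right_ne_zero_of_mul (r1 ▸ n6)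
  have hS : s ^ k.choose 2 ≠ 0 := pow_ne_zero _ hs0
  have hsq : 1 - s ^ 2 ≠ 0 := (qRegular_self hs1).one_sub_ne_zero'
  have r3 : (-1) ^ k * (1 - s ^ 2) ^ k * (2 * c / (d * e * (1 - s ^ 2))) ^ k *
      (-(b * d * e / c)) ^ k = (2 * b) ^ k := by
    simp only [← mul_pow]
    congr 1
    generalize 1 - s ^ 2 = S at *
    field_simp
  have h2b : (2 * b) ^ k ≠ 0 := pow_ne_zero _ (mul_ne_zero two_ne_zero hb)
  rw [coeffF, r1]
  have hx' : (-(b * d * e / c)) ^ k ≠ 0 := pow_ne_zero _ (neg_ne_zero.2 hx)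
  generalize qPoch (s ^ 2) (c / (b * d * e) * ((s ^ 2) ^ k)⁻¹) k = Y at *
  generalize qPoch (s ^ 2) (b * c) (2 * k) = X1 at *
  generalize qPoch (s ^ 2) (b * c * (s ^ 2) ^ k / s ^ 2) k = X2 at *
  generalize qPoch (s ^ 2) (b * c / s ^ 2) k = X3 at *
  generalize qPoch (s ^ 2) (c / b) k = X4 at *
  generalize qPoch (s ^ 2) (b * c / d) k = X5 at *
  generalize qPoch (s ^ 2) (b * c / e) k = X6 at *
  generalize qPoch (s ^ 2) (s ^ 2) k = X7 at *
  generalize qPoch (s ^ 2) (c ^ 2 / (d * e * s ^ 2)) k = X8 at *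
  generalize qPoch (s ^ 2) d k = X9 at *
  generalize qPoch (s ^ 2) e k = X10 at *
  generalize kernH (s ^ 2) c d e b = X11 at *
  generalize 1 - b * c * (s ^ 2) ^ (2 * k) / s ^ 2 = E1 at *
  generalize 1 - b * c / s ^ 2 = E2 at *
  generalize s ^ k.choose 2 = S at *
  generalize (-(b * d * e / c)) ^ k = M1 at *
  generalize (2 * c / (d * e * (1 - s ^ 2))) ^ k = M2 at *
  generalize (1 - s ^ 2) ^ k = M3 at *
  generalize (-1 : ℂ) ^ k = M4 at *
  generalize (2 * b) ^ k = M5 at *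
  have hqk : (s ^ 2) ^ k ≠ 0 := pow_ne_zero _ hq0
  generalize (s ^ 2) ^ k = M6 at *
  clear hD r1 hbcreg n6
  rw [← r3] at h2b ⊢
  have hE : X1 = X3 * X2 * E1 / E2 := by rw [eq_div_iff hbcq]; exact r2
  have m4 : M4 ≠ 0 := fun h => h2b (by rw [h]; ring)
  have m3 : M3 ≠ 0 := fun h => h2b (by rw [h]; ring)
  have m2 : M2 ≠ 0 := fun h => h2b (by rw [h]; ring)
  rw [hE]
  field_simp

end Taylor

/-! ### The involution exchanging the two bases -/

section Involution

variable {q b c d e : ℂ}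

/-- In the parameters `b, β, u, v` the involution merely exchanges `b` and `β`; it permutes the
genericity conditions. -/
lemma Generic.involution (h : Generic q b c d e) :
    Generic q (c / (d * e)) (c ^ 2 / (b * d * e)) (c / (b * e)) (c / (b * d)) := by
  have hb := h.b_ne; have hc := h.c_ne; have hd := h.d_ne; have he := h.e_ne
  exact
  { b_ne := by positivity
    c_ne := by positivity
    d_ne := by positivity
    e_ne := by positivity
    reg_bc := by convert h.reg_c3 using 1; field_simp
    reg_c_div_b := by convert h.reg_c_div_b using 1; field_simp
    reg_bc_div_de := by convert h.reg_bc_div_de using 1; field_simp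
    reg_c_div_bde := by convert h.reg_bde_div_c using 1; field_simp
    reg_bde_div_c := by convert h.reg_c_div_bde using 1; field_simp
    reg_c3 := by convert h.reg_bc using 1; field_simp
    bc_ne_q := by convert h.c3_ne_q using 1; field_simp
    reg_bc_div_d := by convert h.reg_c2_div_d2e using 1; field_simp
    reg_bc_div_e := by convert h.reg_c2_div_de2 using 1; field_simp
    c3_ne_q := by convert h.bc_ne_q using 1; field_simp
    reg_c2_div_de2 := by convert h.reg_bc_div_e using 1; field_simp
    reg_c2_div_d2e := by convert h.reg_bc_div_d using 1; field_simp
    reg_b_div_c := by convert h.reg_b_div_c using 1; field_simp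
    grid_b := h.grid_c_div_de
    grid_c_div_de := by
      intro i hi
      convert h.grid_b i hi using 2
      field_simp }

lemma Generic.wpRegular (hq0 : q ≠ 0) (h : Generic q b c d e) :
    WPRegular q b (c / (d * e)) (c / d) (c / e) := by
  have hb := h.b_ne; have hc := h.c_ne; have hd := h.d_ne; have he := h.e_ne
  exact
  { b_ne := hb
    β_ne := by positivity
    u_ne := by positivity
    v_ne := by positivity
    reg_bβ := by convert h.reg_bc_div_de using 1; ring
    reg_b_div_β := by convert h.reg_bde_div_c using 1; field_simp
    reg_β_div_b := by convert h.reg_c_div_bde using 1; field_simp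
    reg_c_div_b := by convert h.reg_c_div_b using 1; field_simp
    reg_bc := by convert h.reg_bc.div_q hq0 h.bc_ne_q using 1; field_simp
    reg_βγ := by convert h.reg_c3.div_q hq0 h.c3_ne_q using 1; field_simp }

lemma kernK_eq_kernH (h : Generic q b c d e) :
    kernK q b c d e = kernH q (c ^ 2 / (b * d * e)) (c / (b * e)) (c / (b * d)) := by
  have hb := h.b_ne; have hc := h.c_ne; have hd := h.d_ne; have he := h.e_ne
  funext z
  have e1 : c ^ 2 / (b * d * e) / (c / (b * e)) = c / d := by field_simp
  have e2 : c ^ 2 / (b * d * e) / (c / (b * d)) = c / e := by field_simp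
  have e3 : c ^ 2 / (b * d * e) / (c / (b * e) * (c / (b * d))) = b := by field_simp
  simp only [kernK, kernH, ← div_div _ _ z, mul_div_right_comm _ z, e1, e2, e3]
  ring

lemma coeffG_eq_coeffF (h : Generic q b c d e) :
    coeffG q b c d e = coeffF q (c / (d * e)) (c ^ 2 / (b * d * e)) (c / (b * e)) (c / (b * d)) := by
  have hb := h.b_ne; have hc := h.c_ne; have hd := h.d_ne; have he := h.e_ne
  funext k
  have e1 : c / (d * e) * (c ^ 2 / (b * d * e)) = c ^ 3 / (b * d ^ 2 * e ^ 2) := by field_simp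
  have e2 : (c ^ 2 / (b * d * e)) ^ 2 / (c / (b * e) * (c / (b * d)) * q) = c ^ 2 / (d * e * q) := by
    rw [← div_div, ← div_div _ _ q]; congr 1; field_simp
  have e3 : c / (d * e) * (c / (b * e)) * (c / (b * d)) * q / (c ^ 2 / (b * d * e)) =
      c * q / (b * d * e) := by field_simp
  have e4 : c ^ 3 / (b * d ^ 2 * e ^ 2) / (c / (b * e)) = c ^ 2 / (d ^ 2 * e) := by field_simp
  have e5 : c ^ 3 / (b * d ^ 2 * e ^ 2) / (c / (b * d)) = c ^ 2 / (d * e ^ 2) := by field_simp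
  have e6 : c ^ 3 * q ^ (2 * k) / (b * d ^ 2 * e ^ 2 * q) =
      c ^ 3 / (b * d ^ 2 * e ^ 2) * q ^ (2 * k) / q := by rw [← div_div]; ring
  simp only [coeffG, coeffF, e1, e2, e3, e4, e5, e6, ← div_div _ _ q]
  ring

lemma Psi_eq_Phi (q b c d e : ℂ) :
    Psi q b c d e = Phi q (c / (d * e)) (c ^ 2 / (b * d * e)) := by
  funext k z
  simp only [Psi, Phi, ← div_div _ _ z, mul_div_right_comm _ z]

lemma prefB_eq_prefA (h : Generic q b c d e) :
    prefB q b c =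
      prefA q (c / (d * e)) (c ^ 2 / (b * d * e)) (c / (b * e)) (c / (b * d)) := by
  have hb := h.b_ne; have hc := h.c_ne; have hd := h.d_ne; have he := h.e_ne
  funext z
  have e1 : c ^ 2 / (b * d * e) / (c / (b * e) * (c / (b * d))) = b := by field_simp
  have e2 : (c ^ 2 / (b * d * e)) ^ 2 / (c / (d * e) * (c / (b * e)) * (c / (b * d))) = c := by
    field_simp
  simp only [prefB, prefA, ← div_div _ _ z, mul_div_right_comm _ z, e1, e2]

lemma contribPsi_eq_contribPhi (h : Generic q b c d e) :
    contribPsi q b c d e =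
      contribPhi q (c / (d * e)) (c ^ 2 / (b * d * e)) (c / (b * e)) (c / (b * d)) := by
  funext z
  simp only [contribPsi, contribPhi, kernK_eq_kernH h, coeffG_eq_coeffF h, Psi_eq_Phi,
    prefB_eq_prefA h]

lemma Generic.involution_involution (h : Generic q b c d e) :
    c ^ 2 / (b * d * e) / (c / (b * e) * (c / (b * d))) = b ∧
      (c ^ 2 / (b * d * e)) ^ 2 / (c / (d * e) * (c / (b * e)) * (c / (b * d))) = c ∧
      c ^ 2 / (b * d * e) / (c / (d * e) * (c / (b * d))) = d ∧
      c ^ 2 / (b * d * e) / (c / (d * e) * (c / (b * e))) = e := by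
  have hb := h.b_ne; have hc := h.c_ne; have hd := h.d_ne; have he := h.e_ne
  refine ⟨?_, ?_, ?_, ?_⟩ <;> field_simp

lemma contribPhi_eq_contribPsi (h : Generic q b c d e) :
    contribPhi q b c d e =
      contribPsi q (c / (d * e)) (c ^ 2 / (b * d * e)) (c / (b * e)) (c / (b * d)) := by
  obtain ⟨e1, e2, e3, e4⟩ := h.involution_involution
  rw [contribPsi_eq_contribPhi h.involution, e1, e2, e3, e4]

lemma admissibleK_eq_admissibleH (h : Generic q b c d e) :
    admissibleK q b c d e =
      admissibleH q (c / (d * e)) (c ^ 2 / (b * d * e)) (c / (b * e)) (c / (b * d)) := by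
  obtain ⟨e1, e2, -, -⟩ := h.involution_involution
  ext z
  simp only [admissibleK, admissibleH, poleFree, Set.mem_ofPred_eq, ← div_div _ _ z,
    mul_div_right_comm _ z, e1, e2]
  tauto

lemma admissibleH_eq_admissibleK (h : Generic q b c d e) :
    admissibleH q b c d e =
      admissibleK q (c / (d * e)) (c ^ 2 / (b * d * e)) (c / (b * e)) (c / (b * d)) := by
  obtain ⟨e1, e2, e3, e4⟩ := h.involution_involution
  rw [admissibleK_eq_admissibleH h.involution, e1, e2, e3, e4]

end Involution

/-! ### The two-basis expansion -/

section Expansion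

variable {q b c d e z : ℂ}

/-- Bridge to the summation: the finite denominators of `f_k` are absorbed into the infinite
products of `H(b)`, leaving tails starting at `q ^ k`. -/
lemma kernH_mul_coeffF (hq0 : q ≠ 0) (hq1 : ‖q‖ < 1) (h : Generic q b c d e) (k : ℕ) :
    kernH q c d e b * coeffF q b c d e k =
      wpRatio q b (c / (d * e)) (c / d) (c / e) k * q ^ k := by
  have hb := h.b_ne; have hc := h.c_ne; have hd := h.d_ne; have he := h.e_ne
  have c1 : c / d * (c / e) / (c / (d * e)) = c := by field_simp
  have c2 : c / d * (c / e) / (b * (c / (d * e))) = c / b := by field_simp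
  have c3 : c / e / (c / (d * e)) = d := by field_simp
  have c4 : c / d / (c / (d * e)) = e := by field_simp
  have c5 : c / d * (c / e) / q = c ^ 2 / (d * e * q) := by rw [← div_div _ _ q]; congr 1; field_simp
  have c6 : b / (c / (d * e)) * q = b * d * e * q / c := by field_simp
  have n1 := qPoch_ne_zero h.reg_bc_div_d k
  have n2 := qPoch_ne_zero h.reg_bc_div_e k
  have n3 := qPoch_ne_zero (h.reg_bc.div_q hq0 h.bc_ne_q) k
  have n4 := (h.reg_bc.div_q hq0 h.bc_ne_q).one_sub_ne_zero'
  have e1 : qPochInf q (c * b / d) = qPoch q (b * c / d) k * qPochInf q (c / d * b * q ^ k) := by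
    rw [show c * b / d = b * c / d by ring, show c / d * b = b * c / d by ring,
      ← qPochInf_eq_mul hq1]
  have e2 : qPochInf q (c * b / e) = qPoch q (b * c / e) k * qPochInf q (c / e * b * q ^ k) := by
    rw [show c * b / e = b * c / e by ring, show c / e * b = b * c / e by ring,
      ← qPochInf_eq_mul hq1]
  have e3 : qPochInf q (c * b) * (1 - b * c / q) =
      qPoch q (b * c / q) k * qPochInf q (b * c / q * q ^ k) := by
    rw [← qPochInf_eq_mul hq1, qPochInf_eq_one_sub_mul hq1 (b * c / q), div_mul_cancel₀ _ hq0]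
    ring_nf
  have e3' : qPochInf q (c * b) =
      qPoch q (b * c / q) k * qPochInf q (b * c / q * q ^ k) / (1 - b * c / q) := by
    rw [eq_div_iff n4, e3]
  simp only [wpRatio, c1, c2, c3, c4, c5, c6, kernH, coeffF]
  rw [e1, e2, e3', show b * c * q ^ (2 * k) / q = b * c / q * q ^ (2 * k) by ring,
    show c / (d * b) = c / d / b by rw [div_div], show c / (e * b) = c / e / b by rw [div_div],
    show c * b / (d * e) = b * (c / (d * e)) by ring,
    show c / (d * e * b) = c / (d * e) / b by rw [div_div]]
  have hr : ∀ P₁ P₂ P₃ W I₁ I₂ I₃ I₄ I₅ I₆ I₇ I₈ T D E F Q R q' : ℂ, P₁ ≠ 0 → P₂ ≠ 0 → P₃ ≠ 0 →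
      W ≠ 0 → P₁ * I₁ * I₂ * (P₂ * I₃) * I₄ / (P₃ * I₅ / W * I₆ * I₇ * I₈) *
        (T / W * ((P₃ * D * E * F) / (Q * P₁ * P₂ * R)) * q') =
      I₁ * I₃ * I₂ * I₄ * T * (D * E * F) / (I₅ * I₆ * I₇ * I₈ * (Q * R)) * q' := by
    intro P₁ P₂ P₃ W I₁ I₂ I₃ I₄ I₅ I₆ I₇ I₈ T D E F Q R q' h1 h2 h3 h4
    have : P₁ * P₂ * P₃ * W * (P₁ * P₂ * P₃ * W)⁻¹ = 1 := mul_inv_cancel₀ (by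
      exact mul_ne_zero (mul_ne_zero (mul_ne_zero h1 h2) h3) h4)
    simp only [div_eq_mul_inv, mul_inv, inv_inv] at this ⊢
    linear_combination (I₁ * I₃ * I₂ * I₄ * T * (D * E * F) * (I₅⁻¹ * I₆⁻¹ * I₇⁻¹ * I₈⁻¹ *
      (Q⁻¹ * R⁻¹)) * q') * this
  exact hr _ _ _ _ _ _ _ _ _ _ _ _ _ _ _ _ _ _ _ n1 n2 n3 n4

lemma Phi_eq_wpTerm_div (hq1 : ‖q‖ < 1) (h1 : QRegular q (c * z)) (h2 : QRegular q (c / z))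
    (k : ℕ) :
    Phi q b c k z = wpTerm q b c z k / (qPochInf q (c * z) * qPochInf q (c / z)) := by
  have n3 := qPochInf_ne_zero hq1 (h1.shift k)
  have n4 := qPochInf_ne_zero hq1 (h2.shift k)
  rw [Phi, wpTerm, qPochInf_eq_mul hq1 (c * z) k, qPochInf_eq_mul hq1 (c / z) k,
    ← mul_div_mul_right _ _ (mul_ne_zero n3 n4)]
  congr 1
  ring

/-- The common denominator in `z` of the two contributions. -/
noncomputable def commonDenom (q b c d e z : ℂ) : ℂ :=
  qPochInf q (c * z) * qPochInf q (c / z) *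
    (qPochInf q (c ^ 2 * z / (b * d * e)) * qPochInf q (c ^ 2 / (b * d * e * z)))

lemma commonDenom_ne_zero (hq1 : ‖q‖ < 1) (hz : z ∈ poleFree q b c d e) :
    commonDenom q b c d e z ≠ 0 := by
  obtain ⟨-, h1, h2, h3, h4⟩ := hz
  exact mul_ne_zero (mul_ne_zero (qPochInf_ne_zero hq1 h1) (qPochInf_ne_zero hq1 h2))
    (mul_ne_zero (qPochInf_ne_zero hq1 h3) (qPochInf_ne_zero hq1 h4))

lemma contribPhi_eq_wpSeries_div (hq0 : q ≠ 0) (hq1 : ‖q‖ < 1) (h : Generic q b c d e)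
    (h1 : QRegular q (c * z)) (h2 : QRegular q (c / z)) :
    contribPhi q b c d e z =
      wpSeries q b (c / (d * e)) (c / d) (c / e) z / commonDenom q b c d e z := by
  have hb := h.b_ne; have hc := h.c_ne; have hd := h.d_ne; have he := h.e_ne
  have c1 : c / d * (c / e) / (c / (d * e)) = c := by field_simp
  have hsum : kernH q c d e b * ∑' k, coeffF q b c d e k * Phi q b c k z =
      (∑' k, wpRatio q b (c / (d * e)) (c / d) (c / e) k * q ^ k * wpTerm q b c z k) /
        (qPochInf q (c * z) * qPochInf q (c / z)) := by
    rw [← tsum_mul_left, ← tsum_div_const]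
    congr 1
    funext k
    rw [Phi_eq_wpTerm_div hq1 h1 h2, ← kernH_mul_coeffF hq0 hq1 h]
    ring
  rw [contribPhi, mul_assoc, hsum, wpSeries, c1, prefA, commonDenom, div_mul_div_comm,
    show c * z / (d * e) = c / (d * e) * z by ring,
    show c / (d * e * z) = c / (d * e) / z by rw [div_div]]
  congr 1
  ring

lemma commonDenom_involution (h : Generic q b c d e) (z : ℂ) :
    commonDenom q (c / (d * e)) (c ^ 2 / (b * d * e)) (c / (b * e)) (c / (b * d)) z =
      commonDenom q b c d e z := by
  obtain ⟨-, e2, -, -⟩ := h.involution_involution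
  simp only [commonDenom, ← div_div _ _ z, mul_div_right_comm _ z, e2]
  ring

/-- The two-basis expansion of the kernel. -/
theorem prefA_mul_kernH (hq0 : q ≠ 0) (hq1 : ‖q‖ < 1) (h : Generic q b c d e)
    (hz : z ∈ admissibleH q b c d e) :
    prefA q b c d e z * kernH q c d e z = contribPhi q b c d e z + contribPsi q b c d e z := by
  have hb := h.b_ne; have hc := h.c_ne; have hd := h.d_ne; have he := h.e_ne
  obtain ⟨⟨hz0, h1, h2, h3, h4⟩, h5, h6⟩ := hz
  have k1 : c ^ 2 / (b * d * e) / (c / (b * e) * (c / (b * d))) = b := by field_simp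
  have k2 : c ^ 2 / (b * d * e) / (c / (b * e)) = c / d := by field_simp
  have k3 : c ^ 2 / (b * d * e) / (c / (b * d)) = c / e := by field_simp
  rw [contribPsi_eq_contribPhi h, contribPhi_eq_wpSeries_div hq0 hq1 h h1 h2,
    contribPhi_eq_wpSeries_div hq0 hq1 h.involution (by convert h3 using 1; ring)
      (by rw [div_div]; exact h4), commonDenom_involution h, k1, k2, k3, ← add_div,
    wpSeries_add_wpSeries hq0 hq1 hz0 (h.wpRegular hq0)]
  -- The factors `(cz/de, c/dez; q)_∞` cancel between `A` and `H`, which is where admissibility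
  -- beyond `poleFree` enters.
  have n5 := qPochInf_ne_zero hq1 h5
  have n6 := qPochInf_ne_zero hq1 h6
  rw [prefA, kernH, commonDenom, div_mul_div_comm,
    ← mul_div_mul_right _ (_ * (_ * qPochInf q (c ^ 2 / (b * d * e * z)))) (mul_ne_zero n5 n6)]
  simp only [← div_div _ _ z, mul_div_right_comm _ z]
  congr 1 <;> ring

end Expansion

/-! ### Convergence on compact sets -/

section Convergence

variable {q b c d e z : ℂ}

lemma unifBdd_of_continuousOn {κ : Type*} {L : Set ℂ} (hL : IsCompact L) {g : ℂ → ℂ}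
    (hg : ContinuousOn g L) : UnifBdd fun p : L × κ => g p.1 := by
  obtain ⟨C, hC⟩ := hL.exists_bound_of_continuousOn hg
  exact ⟨C, fun p => hC p.1 p.1.2⟩

lemma unifBdd_inv_qPoch_of_continuousOn {κ : Type*} (hq1 : ‖q‖ < 1) {L : Set ℂ} (hL : IsCompact L)
    {g : ℂ → ℂ} (hg : ContinuousOn g L) (hreg : ∀ z ∈ L, QRegular q (g z)) (n : κ → ℕ) :
    UnifBdd fun p : L × κ => (qPoch q (g p.1) (n p.2))⁻¹ := by
  obtain ⟨δ, hδ, h⟩ := exists_le_norm_qPoch hq1 (hL.image_of_continuousOn hg)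
    (by rintro _ ⟨z, hz, rfl⟩; exact hreg z hz)
  exact unifBdd_inv_of_le hδ fun p => by
    simpa using h _ (Set.mem_image_of_mem g p.1.2) 0 (n p.2)

/-- The coefficient `f_k` without its factor `q ^ k`. -/
noncomputable def coeffFRatio (q b c d e : ℂ) (k : ℕ) : ℂ :=
  (1 - b * c * q ^ (2 * k) / q) / (1 - b * c / q) *
    ((qPoch q (b * c / q) k * qPoch q d k * qPoch q e k * qPoch q (c ^ 2 / (d * e * q)) k) /
      (qPoch q q k * qPoch q (b * c / d) k * qPoch q (b * c / e) k *
        qPoch q (b * d * e * q / c) k))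

lemma unifBdd_coeffFRatio (hq1 : ‖q‖ < 1) (h : Generic q b c d e) :
    UnifBdd (coeffFRatio q b c d e) := by
  have hn : ∀ x : ℂ, UnifBdd fun k : ℕ => qPoch q x k := fun x => (unifBdd_const x).qPoch hq1 _
  have hp : UnifBdd fun k : ℕ => 1 - b * c * q ^ (2 * k) / q :=
    (unifBdd_const 1).sub ((unifBdd_mul_pow hq1 (b * c / q) fun k => 2 * k).congr fun k => by ring)
  have d1 := unifBdd_inv_qPoch hq1 (qRegular_self hq1) fun k : ℕ => k
  have d2 := unifBdd_inv_qPoch hq1 h.reg_bc_div_d fun k : ℕ => k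
  have d3 := unifBdd_inv_qPoch hq1 h.reg_bc_div_e fun k : ℕ => k
  have d4 := unifBdd_inv_qPoch hq1 (x := b * d * e * q / c)
    (by convert h.reg_bde_div_c.mul_q using 1; ring) fun k : ℕ => k
  refine UnifBdd.congr ((hp.mul (unifBdd_const (1 - b * c / q)⁻¹)).mul
    ((((hn (b * c / q)).mul (hn d)).mul (hn e)).mul (hn (c ^ 2 / (d * e * q))) |>.mul
      (((d1.mul d2).mul d3).mul d4))) fun k => ?_
  simp only [coeffFRatio, div_eq_mul_inv, mul_inv]

lemma unifBdd_Phi (hq1 : ‖q‖ < 1) {L : Set ℂ} (hL : IsCompact L) (hL0 : ∀ z ∈ L, z ≠ 0)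
    (h1 : ∀ z ∈ L, QRegular q (c * z)) (h2 : ∀ z ∈ L, QRegular q (c / z)) :
    UnifBdd fun p : L × ℕ => Phi q b c p.2 p.1 := by
  have hm : ∀ a : ℂ, ContinuousOn (fun z => a * z) L := fun a => by fun_prop
  have hd : ∀ a : ℂ, ContinuousOn (fun z => a / z) L := fun a =>
    continuousOn_const.div continuousOn_id hL0
  have n1 := (unifBdd_of_continuousOn (κ := ℕ) hL (hm b)).qPoch hq1 fun p => p.2
  have n2 := (unifBdd_of_continuousOn (κ := ℕ) hL (hd b)).qPoch hq1 fun p => p.2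
  have d1 := unifBdd_inv_qPoch_of_continuousOn hq1 hL (hm c) h1 fun k : ℕ => k
  have d2 := unifBdd_inv_qPoch_of_continuousOn hq1 hL (hd c) h2 fun k : ℕ => k
  refine UnifBdd.congr ((n1.mul n2).mul (d1.mul d2)) fun p => ?_
  simp only [Phi, div_eq_mul_inv, mul_inv]

/-- The terms of the `(b, c)`-series decay geometrically, uniformly on compact sets. -/
lemma exists_norm_coeffF_mul_Phi_le (hq1 : ‖q‖ < 1) (h : Generic q b c d e) {L : Set ℂ}
    (hL : IsCompact L) (hsub : L ⊆ poleFree q b c d e) :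
    ∃ C, ∀ z ∈ L, ∀ k, ‖coeffF q b c d e k * Phi q b c k z‖ ≤ C * ‖q‖ ^ k := by
  obtain ⟨C, hC⟩ := ((unifBdd_coeffFRatio hq1 h).comp (fun p : L × ℕ => p.2)).mul
    (unifBdd_Phi (b := b) hq1 hL (fun z hz => (hsub hz).1) (fun z hz => (hsub hz).2.1)
      fun z hz => (hsub hz).2.2.1)
  refine ⟨C, fun z hz k => ?_⟩
  have := hC (⟨z, hz⟩, k)
  rw [show coeffF q b c d e k = coeffFRatio q b c d e k * q ^ k from rfl, mul_right_comm, norm_mul,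
    norm_pow]
  gcongr

lemma summable_coeffF_mul_Phi (hq1 : ‖q‖ < 1) (h : Generic q b c d e)
    (hz : z ∈ poleFree q b c d e) : Summable fun k => coeffF q b c d e k * Phi q b c k z := by
  obtain ⟨C, hC⟩ := exists_norm_coeffF_mul_Phi_le hq1 h isCompact_singleton
    (Set.singleton_subset_iff.2 hz)
  exact Summable.of_norm_bounded ((summable_geometric_of_lt_one (norm_nonneg _) hq1).mul_left C)
    (hC z rfl)

lemma poleFree_involution (h : Generic q b c d e) :
    poleFree q (c / (d * e)) (c ^ 2 / (b * d * e)) (c / (b * e)) (c / (b * d)) =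
      poleFree q b c d e := by
  obtain ⟨-, e2, -, -⟩ := h.involution_involution
  ext z
  simp only [poleFree, Set.mem_ofPred_eq, ← div_div _ _ z, mul_div_right_comm _ z, e2]
  tauto

lemma summable_coeffG_mul_Psi (hq1 : ‖q‖ < 1) (h : Generic q b c d e)
    (hz : z ∈ poleFree q b c d e) :
    Summable fun k => coeffG q b c d e k * Psi q b c d e k z := by
  rw [coeffG_eq_coeffF h, Psi_eq_Phi]
  exact summable_coeffF_mul_Phi hq1 h.involution (by rwa [poleFree_involution h])

/-- The remainder of the kernel is a tail of the `(b, c)`-series plus the complementary series. -/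
theorem prefA_mul_taylorRemainder {s : ℂ} (hs0 : s ≠ 0) (hs1 : ‖s ^ 2‖ < 1)
    (h : Generic (s ^ 2) b c d e) (hz : z ∈ admissibleH (s ^ 2) b c d e) (n : ℕ) :
    prefA (s ^ 2) b c d e z * taylorRemainder (s ^ 2) s b c (kernH (s ^ 2) c d e) n z =
      prefA (s ^ 2) b c d e z * kernH (s ^ 2) c d e b *
          (∑' k : ℕ, coeffF (s ^ 2) b c d e (n + 1 + k) * Phi (s ^ 2) b c (n + 1 + k) z) +
        contribPsi (s ^ 2) b c d e z := by
  have h1 := prefA_mul_kernH (pow_ne_zero 2 hs0) hs1 h hz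
  have h2 := (summable_coeffF_mul_Phi hs1 h hz.1).sum_add_tsum_nat_add (n + 1)
  simp only [add_comm _ (n + 1)] at h2
  rw [taylorRemainder, taylorSum, mul_sub, h1, contribPhi, ← h2]
  simp only [taylorCoeff_kernH hs0 hs1 h, mul_assoc, ← Finset.mul_sum]
  ring

lemma exists_norm_prefA_le (hq1 : ‖q‖ < 1) {L : Set ℂ} (hL : IsCompact L)
    (hsub : L ⊆ poleFree q b c d e) : ∃ C, ∀ z ∈ L, ‖prefA q b c d e z‖ ≤ C := by
  refine hL.exists_bound_of_continuousOn ?_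
  have hi := continuous_qPochInf hq1
  have hd : ∀ a : ℂ, ContinuousOn (fun z => qPochInf q (a / z)) L := fun a =>
    hi.comp_continuousOn (continuousOn_const.div continuousOn_id fun z hz => (hsub hz).1)
  have hm : ∀ a : ℂ, ContinuousOn (fun z => qPochInf q (a * z)) L := fun a =>
    (hi.comp (continuous_const_mul a)).continuousOn
  have := ((hm (c / (d * e))).mul (hd (c / (d * e)))).div
    ((hm (c ^ 2 / (b * d * e))).mul (hd (c ^ 2 / (b * d * e)))) fun z hz => by
      obtain ⟨-, -, -, h3, h4⟩ := hsub hz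
      rw [mul_div_right_comm] at h3
      rw [← div_div] at h4
      exact mul_ne_zero (qPochInf_ne_zero hq1 h3) (qPochInf_ne_zero hq1 h4)
  refine this.congr fun z _ => ?_
  simp only [prefA, Pi.div_apply, Pi.mul_apply, ← div_div _ _ z, mul_div_right_comm _ z]

theorem tendstoUniformlyOn_taylorRemainder {s : ℂ} (hs0 : s ≠ 0) (hs1 : ‖s ^ 2‖ < 1)
    (h : Generic (s ^ 2) b c d e) {L : Set ℂ} (hL : IsCompact L)
    (hsub : L ⊆ admissibleH (s ^ 2) b c d e) :
    TendstoUniformlyOn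
      (fun (n : ℕ) (z : ℂ) => prefA (s ^ 2) b c d e z *
        taylorRemainder (s ^ 2) s b c (kernH (s ^ 2) c d e) n z)
      (contribPsi (s ^ 2) b c d e) atTop L := by
  have hsub' : L ⊆ poleFree (s ^ 2) b c d e := fun z hz => (hsub hz).1
  obtain ⟨C, hC⟩ := exists_norm_coeffF_mul_Phi_le hs1 h hL hsub'
  obtain ⟨D, hD⟩ := exists_norm_prefA_le hs1 hL hsub'
  have hgeo := summable_geometric_of_lt_one (norm_nonneg _) hs1
  -- `D` bounds the prefactor on `L`, and `C` times a geometric tail bounds the series, so the error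
  -- is at most `M * ‖q‖ ^ (n + 1)`.
  set M : ℝ := D * ‖kernH (s ^ 2) c d e b‖ * (C * ∑' k : ℕ, ‖s ^ 2‖ ^ k) with hM
  have hlim : Tendsto (fun n : ℕ => M * ‖s ^ 2‖ ^ (n + 1)) atTop (𝓝 0) := by
    simpa using ((tendsto_add_atTop_iff_nat 1).2
      (tendsto_pow_atTop_nhds_zero_of_lt_one (norm_nonneg _) hs1)).const_mul M
  rw [Metric.tendstoUniformlyOn_iff]
  intro ε hε
  filter_upwards [hlim.eventually_lt_const hε] with n hn z hz
  refine lt_of_le_of_lt ?_ hn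
  rw [prefA_mul_taylorRemainder hs0 hs1 h (hsub hz), dist_eq_norm, sub_add_cancel_right, norm_neg,
    norm_mul, norm_mul]
  have htail : ‖∑' k : ℕ, coeffF (s ^ 2) b c d e (n + 1 + k) * Phi (s ^ 2) b c (n + 1 + k) z‖ ≤
      C * ‖s ^ 2‖ ^ (n + 1) * ∑' k : ℕ, ‖s ^ 2‖ ^ k := by
    rw [← tsum_mul_left]
    refine tsum_of_norm_bounded (hgeo.mul_left _).hasSum fun k => ?_
    rw [mul_assoc, ← pow_add]
    exact hC z hz _
  calc _ ≤ D * ‖kernH (s ^ 2) c d e b‖ * (C * ‖s ^ 2‖ ^ (n + 1) * ∑' k : ℕ, ‖s ^ 2‖ ^ k) :=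
        mul_le_mul (mul_le_mul_of_nonneg_right (hD z hz) (norm_nonneg _)) htail (norm_nonneg _)
          (mul_nonneg ((norm_nonneg _).trans (hD z hz)) (norm_nonneg _))
    _ = _ := by rw [hM]; ring

end Convergence

/-! ### Nonvanishing of the limits -/

section Nonvanishing

variable {q b c d e z : ℂ}

lemma countable_not_qRegular_mul (q a : ℂ) : {z : ℂ | ¬QRegular q (a * z)}.Countable := by
  refine (Set.countable_range fun m : ℕ => (a * q ^ m)⁻¹).mono fun z hz => ?_
  simp only [QRegular, Set.mem_ofPred_eq, not_forall, not_not] at hz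
  obtain ⟨m, hm⟩ := hz
  exact ⟨m, inv_eq_of_mul_eq_one_right (by rw [← hm]; ring)⟩

lemma countable_not_qRegular_div (q a : ℂ) : {z : ℂ | ¬QRegular q (a / z)}.Countable := by
  refine (Set.countable_range fun m : ℕ => a * q ^ m).mono fun z hz => ?_
  simp only [QRegular, Set.mem_ofPred_eq, not_forall, not_not] at hz
  obtain ⟨m, hm⟩ := hz
  have hz0 : z ≠ 0 := by rintro rfl; simp at hm
  exact ⟨m, by field_simp at hm; exact hm⟩

/-- Only countably many points are excluded. -/
lemma dense_admissibleK (q b c d e : ℂ) : Dense (admissibleK q b c d e) := by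
  have h1 := (((Set.countable_singleton (0 : ℂ)).union
    ((countable_not_qRegular_mul q c).union (countable_not_qRegular_div q c))).union
    ((countable_not_qRegular_mul q (c ^ 2 / (b * d * e))).union
      (countable_not_qRegular_div q (c ^ 2 / (b * d * e))))).union
    ((countable_not_qRegular_mul q b).union (countable_not_qRegular_div q b))
  refine (h1.dense_compl ℝ).mono fun z hz => ?_
  simp only [Set.mem_compl_iff, Set.mem_union, Set.mem_singleton_iff, Set.mem_ofPred_eq, not_or,
    not_not] at hz
  simp only [admissibleK, poleFree, Set.mem_ofPred_eq, ← div_div _ _ z, mul_div_right_comm _ z]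
  tauto

lemma continuousAt_wpSeries {β u v : ℂ} (hq1 : ‖q‖ < 1) (h : WPRegular q b β u v) :
    ContinuousAt (wpSeries q b β u v) b := by
  have hb := h.b_ne
  have hi := continuous_qPochInf hq1
  have hdiv : ∀ a : ℂ, ContinuousAt (fun z => a / z) b := fun a =>
    continuousAt_const.div continuousAt_id hb
  have hmul : ∀ a : ℂ, ContinuousAt (fun z => a * z) b := fun a => by fun_prop
  refine ContinuousAt.mul ((hi.continuousAt.comp (hmul β)).mul (hi.continuousAt.comp (hdiv β))) ?_
  -- A compact neighbourhood of `b` that avoids the origin, on which the terms are dominated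
  -- uniformly.
  set L := Metric.closedBall b (‖b‖ / 2) with hL
  have hbpos : 0 < ‖b‖ := norm_pos_iff.2 hb
  have hL0 : ∀ z ∈ L, z ≠ 0 := by
    rintro z hz rfl
    rw [hL, Metric.mem_closedBall, dist_zero_left] at hz
    linarith
  have hLc : IsCompact L := isCompact_closedBall _ _
  have hm' : ∀ a : ℂ, ContinuousOn (fun z => a * z) L := fun a => by fun_prop
  have hd' : ∀ a : ℂ, ContinuousOn (fun z => a / z) L := fun a =>
    continuousOn_const.div continuousOn_id hL0
  have hp := unifBdd_mul_pow (ι := L × ℕ) hq1 1 fun p => p.2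
  simp only [one_mul] at hp
  have n1 := (unifBdd_of_continuousOn (κ := ℕ) hLc (hm' b)).qPoch hq1 fun p => p.2
  have n2 := (unifBdd_of_continuousOn (κ := ℕ) hLc (hd' b)).qPoch hq1 fun p => p.2
  have n3 := ((unifBdd_of_continuousOn (κ := ℕ) hLc (hm' (u * v / β))).mul hp).qPochInf hq1
  have n4 := ((unifBdd_of_continuousOn (κ := ℕ) hLc (hd' (u * v / β))).mul hp).qPochInf hq1
  have n5 := (unifBdd_wpRatio hq1 h).comp fun p : L × ℕ => (0, p.2)
  simp only [pow_zero, mul_one] at n5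
  obtain ⟨C, hC⟩ := n5.mul ((n1.mul n2).mul (n3.mul n4))
  refine tendsto_tsum_of_dominated_convergence (bound := fun k => C * ‖q‖ ^ k)
    ((summable_geometric_of_lt_one (norm_nonneg _) hq1).mul_left _) (fun k => ?_) ?_
  · refine Tendsto.const_mul _ ?_
    have c1 : ContinuousAt (fun z => qPoch q (b * z) k) b :=
      (continuous_qPoch q k).continuousAt.comp (hmul b)
    have c2 : ContinuousAt (fun z => qPoch q (b / z) k) b :=
      (continuous_qPoch q k).continuousAt.comp (f := fun z => b / z) (hdiv b)
    have c3 : ContinuousAt (fun z => qPochInf q (u * v / β * z * q ^ k)) b :=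
      hi.continuousAt.comp ((hmul _).mul continuousAt_const)
    have c4 : ContinuousAt (fun z => qPochInf q (u * v / β / z * q ^ k)) b :=
      hi.continuousAt.comp (f := fun z => u * v / β / z * q ^ k) ((hdiv _).mul continuousAt_const)
    exact (c1.mul c2).mul (c3.mul c4)
  · filter_upwards [Metric.closedBall_mem_nhds b (half_pos hbpos)] with z hz k
    rw [mul_right_comm, norm_mul, norm_pow]
    gcongr
    exact hC (⟨z, hz⟩, k)

/-- The `(b, c)`-contribution does not vanish identically. -/
theorem exists_contribPhi_ne_zero (hq0 : q ≠ 0) (hq1 : ‖q‖ < 1) (h : Generic q b c d e)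
    (hH : kernH q c d e b ≠ 0) : ∃ z ∈ admissibleK q b c d e, contribPhi q b c d e z ≠ 0 := by
  have hb := h.b_ne; have hc := h.c_ne; have hd := h.d_ne; have he := h.e_ne
  have hw := h.wpRegular hq0
  have c1 : c / d * (c / e) / (c / (d * e)) = c := by field_simp
  -- At `z = b` the factor `(b/z; q)_k = (1; q)_k` kills every term with `k ≥ 1`. The point `b` is
  -- not itself admissible, so a nearby admissible point is taken afterwards.
  have hne : wpSeries q b (c / (d * e)) (c / d) (c / e) b ≠ 0 := by
    have h0 := kernH_mul_coeffF hq0 hq1 h 0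
    have hF : coeffF q b c d e 0 = 1 := by
      simp [coeffF, div_self (h.reg_bc.div_q hq0 h.bc_ne_q).one_sub_ne_zero']
    rw [hF, mul_one] at h0
    rw [wpSeries, tsum_eq_single 0, ← h0]
    · simp only [wpTerm, qPoch_zero, pow_zero, mul_one, one_mul, c1]
      refine mul_ne_zero (mul_ne_zero (qPochInf_ne_zero hq1 ?_) (qPochInf_ne_zero hq1 ?_))
        (mul_ne_zero hH (mul_ne_zero (qPochInf_ne_zero hq1 ?_) (qPochInf_ne_zero hq1 ?_)))
      · rw [mul_comm]; exact hw.reg_bβ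
      · exact hw.reg_β_div_b
      · rw [mul_comm]; exact h.reg_bc
      · exact h.reg_c_div_b
    · intro k hk
      obtain ⟨m, rfl⟩ := Nat.exists_eq_succ_of_ne_zero hk
      simp [wpTerm, div_self hb, qPoch_one_left]
  have hev : ∀ᶠ z in 𝓝 b, wpSeries q b (c / (d * e)) (c / d) (c / e) z ≠ 0 :=
    (continuousAt_wpSeries hq1 hw).eventually_ne hne
  obtain ⟨z, hz, hzs⟩ := (dense_admissibleK q b c d e).exists_mem_open isOpen_interior
    ⟨b, mem_interior_iff_mem_nhds.2 hev⟩
  refine ⟨z, hz, ?_⟩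
  rw [contribPhi_eq_wpSeries_div hq0 hq1 h hz.1.2.1 hz.1.2.2.1]
  exact div_ne_zero (interior_subset hzs) (commonDenom_ne_zero hq1 hz.1)

end Nonvanishing

end WPTaylor

theorem mainTheorem2 (q s b c d e : ℂ) (hq0 : 0 < ‖q‖) (hq1 : ‖q‖ < 1) (hs : s ^ 2 = q)
    (hgen : WPTaylor.Generic q b c d e) :
    -- the remainder of `H` relative to `(b, c)`
    ((∀ z ∈ WPTaylor.admissibleH q b c d e,
        Summable (fun k : ℕ => WPTaylor.coeffF q b c d e k * WPTaylor.Phi q b c k z) ∧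
        Summable (fun k : ℕ => WPTaylor.coeffG q b c d e k * WPTaylor.Psi q b c d e k z) ∧
        ∀ n : ℕ,
          WPTaylor.prefA q b c d e z *
              WPTaylor.taylorRemainder q s b c (WPTaylor.kernH q c d e) n z =
            WPTaylor.prefA q b c d e z * WPTaylor.kernH q c d e b *
                (∑' k : ℕ, WPTaylor.coeffF q b c d e (n + 1 + k) *
                  WPTaylor.Phi q b c (n + 1 + k) z) +
              WPTaylor.contribPsi q b c d e z) ∧
      (∀ L : Set ℂ, IsCompact L → L ⊆ WPTaylor.admissibleH q b c d e →
        TendstoUniformlyOn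
          (fun (n : ℕ) (z : ℂ) => WPTaylor.prefA q b c d e z *
            WPTaylor.taylorRemainder q s b c (WPTaylor.kernH q c d e) n z)
          (WPTaylor.contribPsi q b c d e) Filter.atTop L) ∧
      (WPTaylor.kernK q b c d e (c / (d * e)) ≠ 0 →
        ∃ z ∈ WPTaylor.admissibleH q b c d e, WPTaylor.contribPsi q b c d e z ≠ 0)) ∧
    -- the remainder of `K` relative to `(c/de, c²/bde)`
    ((∀ z ∈ WPTaylor.admissibleK q b c d e,
        Summable (fun k : ℕ => WPTaylor.coeffF q b c d e k * WPTaylor.Phi q b c k z) ∧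
        Summable (fun k : ℕ => WPTaylor.coeffG q b c d e k * WPTaylor.Psi q b c d e k z) ∧
        ∀ n : ℕ,
          WPTaylor.prefB q b c z *
              WPTaylor.taylorRemainder q s (c / (d * e)) (c ^ 2 / (b * d * e))
                (WPTaylor.kernK q b c d e) n z =
            WPTaylor.prefB q b c z * WPTaylor.kernK q b c d e (c / (d * e)) *
                (∑' k : ℕ, WPTaylor.coeffG q b c d e (n + 1 + k) *
                  WPTaylor.Psi q b c d e (n + 1 + k) z) +
              WPTaylor.contribPhi q b c d e z) ∧
      (∀ L : Set ℂ, IsCompact L → L ⊆ WPTaylor.admissibleK q b c d e →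
        TendstoUniformlyOn
          (fun (n : ℕ) (z : ℂ) => WPTaylor.prefB q b c z *
            WPTaylor.taylorRemainder q s (c / (d * e)) (c ^ 2 / (b * d * e))
              (WPTaylor.kernK q b c d e) n z)
          (WPTaylor.contribPhi q b c d e) Filter.atTop L) ∧
      (WPTaylor.kernH q c d e b ≠ 0 →
        ∃ z ∈ WPTaylor.admissibleK q b c d e, WPTaylor.contribPhi q b c d e z ≠ 0)) := by
  have hq0' : q ≠ 0 := norm_pos_iff.1 hq0
  have hs0 : s ≠ 0 := by rintro rfl; exact hq0' (by rw [← hs]; simp)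
  subst hs
  have hinv := hgen.involution
  -- The expansion and the limit for `K` are those for `H` under the involution; nonvanishing is
  -- transported the other way, from the `(b, c)`-contribution to the complementary one.
  refine ⟨⟨fun z hz => ⟨WPTaylor.summable_coeffF_mul_Phi hq1 hgen hz.1,
      WPTaylor.summable_coeffG_mul_Psi hq1 hgen hz.1,
      WPTaylor.prefA_mul_taylorRemainder hs0 hq1 hgen hz⟩,
    fun L hL hsub => WPTaylor.tendstoUniformlyOn_taylorRemainder hs0 hq1 hgen hL hsub,
    fun hK => ?_⟩,
    fun z hz => ⟨WPTaylor.summable_coeffF_mul_Phi hq1 hgen hz.1,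
      WPTaylor.summable_coeffG_mul_Psi hq1 hgen hz.1, fun n => ?_⟩,
    fun L hL hsub => ?_, WPTaylor.exists_contribPhi_ne_zero hq0' hq1 hgen⟩
  · rw [WPTaylor.kernK_eq_kernH hgen] at hK
    rw [WPTaylor.admissibleH_eq_admissibleK hgen, WPTaylor.contribPsi_eq_contribPhi hgen]
    exact WPTaylor.exists_contribPhi_ne_zero hq0' hq1 hinv hK
  · rw [WPTaylor.admissibleK_eq_admissibleH hgen] at hz
    rw [WPTaylor.prefB_eq_prefA hgen, WPTaylor.kernK_eq_kernH hgen,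
      WPTaylor.coeffG_eq_coeffF hgen, WPTaylor.Psi_eq_Phi, WPTaylor.contribPhi_eq_contribPsi hgen]
    exact WPTaylor.prefA_mul_taylorRemainder hs0 hq1 hinv hz n
  · rw [WPTaylor.admissibleK_eq_admissibleH hgen] at hsub
    rw [WPTaylor.prefB_eq_prefA hgen, WPTaylor.kernK_eq_kernH hgen,
      WPTaylor.contribPhi_eq_contribPsi hgen]
    exact WPTaylor.tendstoUniformlyOn_taylorRemainder hs0 hq1 hinv hL hsub
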